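/- Let $\mathbb{F}_q$ be a finite field with $q$ elements, let $k \ge 2$, and let $R = M_{k\times k}(\mathbb{F}_q)$. A homogeneous weight on $R$ is a function $\mathrm{w}: R \to \mathbb{R}$ for which there is a real number $\zeta>0$ such that (i) $\mathrm{w}(0)=0$; (ii) $\mathrm{w}(ur)=\mathrm{w}(r)$ for all $r\in R$ and all units $u$ of $R$; (iii) $\sum_{x\in Rr}\mathrm{w}(x)=\zeta\,|Rr|$ for every nonzero $r\in R$. Such a weight exists, is unique up to a positive scalar factor, and depends only on the rank of $r$. Let $\mathrm{w}$ be a homogeneous weight on $R$, scaled so that its values are nonnegative integers; write $\mathrm{w}_i$ for its value on matrices of rank $i$ and $\mathrm{w}_{\max}$ for its largest value, and set $\mathrm{w}(x)=\sum_{i=1}^n \mathrm{w}(x_i)$ for $x\in R^n$. For $C\subseteq R^n$ put \[ \mathrm{wwe}_C(X,Y)=\sum_{x\in C}X^{n\mathrm{w}_{\max}-\mathrm{w}(x)}Y^{\mathrm{w}(x)},\qquad A_j(C)=|\{x\in C:\mathrm{w}(x)=j\}|, \] and for a left $R$-submodule $C\subseteq R^n$ (a left linear code) let $C^\perp=\{y\in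 R^n:\sum_{i} x_iy_i=0\text{ for all }x\in C\}$. Say that $\mathrm{w}$ respects duality if, for all $n\ge1$ and all left $R$-linear codes $C,D\subseteq R^n$, $\mathrm{wwe}_C=\mathrm{wwe}_D$ implies $\mathrm{wwe}_{C^\perp}=\mathrm{wwe}_{D^\perp}$. Then $\mathrm{w}$ respects duality if and only if $k=2$ and $q=2$. Moreover, if $(k,q)\neq(2,2)$, then $\mathrm{w}_2<\mathrm{w}_1<2\mathrm{w}_2$, and there exist $n\ge1$ and left $R$-linear codes $C,D\subseteq R^n$ with $\mathrm{wwe}_C=\mathrm{wwe}_D$ and $A_{\mathrm{w}_1}(C^\perp)\neq A_{\mathrm{w}_1}(D^\perp)$. -/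

import Mathlib

/-- `w : R → ℝ` is a homogeneous weight on the finite ring `R`: `w 0 = 0`, `w` is invariant under
left multiplication by units, and all nonzero principal left ideals `R r` have the same average
weight `ζ > 0`. (`Ideal R` is the type of left ideals of `R`.) -/
def IsHomogeneousWeight {R : Type*} [Ring R] [Fintype R] (w : R → ℝ) : Prop :=
  w 0 = 0 ∧
  (∀ (u : Rˣ) (r : R), w (u * r) = w r) ∧
  ∃ ζ : ℝ, 0 < ζ ∧ ∀ r : R, r ≠ 0 →
    ∑ᶠ x ∈ (Ideal.span {r} : Ideal R), w x = ζ * Nat.card (Ideal.span {r} : Ideal R)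

/-- The additive extension of a weight on `R` to vectors: `w(v) = ∑ i, w(v i)`. -/
def vecWeight {R : Type*} (w : R → ℕ) {n : ℕ} (v : Fin n → R) : ℕ := ∑ i, w (v i)

/-- The largest value of the weight `w`. -/
def maxWeight {R : Type*} [Fintype R] (w : R → ℕ) : ℕ := Finset.univ.sup w

open Classical in
/-- The `w`-weight enumerator `∑_{x ∈ C} X ^ (n * w_max - w(x)) * Y ^ w(x)` of `C ⊆ R ^ n`, where
`X` and `Y` are the variables with index `0` and `1`. The subtraction never truncates, since
`w(x) ≤ n * w_max`. -/
noncomputable def weightEnumerator {R : Type*} [Fintype R] (w : R → ℕ) {n : ℕ}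
    (C : Set (Fin n → R)) : MvPolynomial (Fin 2) ℤ :=
  ∑ x : Fin n → R with x ∈ C,
    MvPolynomial.X 0 ^ (n * maxWeight w - vecWeight w x) * MvPolynomial.X 1 ^ vecWeight w x

/-- `A_j(C)`: the number of vectors of `C` of weight `j`. -/
noncomputable def weightCount {R : Type*} (w : R → ℕ) {n : ℕ} (j : ℕ) (C : Set (Fin n → R)) : ℕ :=
  Set.ncard {x | x ∈ C ∧ vecWeight w x = j}

/-- The right dual code `{y | x ⬝ y = 0 for all x ∈ C}` of a left linear code `C`;
it is a right submodule of `R ^ n`. -/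
def rightDual {R : Type*} [Ring R] {n : ℕ} (C : Submodule R (Fin n → R)) :
    Submodule Rᵐᵒᵖ (Fin n → R) where
  carrier := {y | ∀ x ∈ C, ∑ i, x i * y i = 0}
  zero_mem' := by simp
  add_mem' := by
    intro a b ha hb x hx
    simp [mul_add, Finset.sum_add_distrib, ha x hx, hb x hx]
  smul_mem' := by
    intro c y hy x hx
    have h := congrArg (fun t => t * c.unop) (hy x hx)
    simpa [Finset.sum_mul, mul_assoc] using h

/-- The weight `w` respects duality: left linear codes of the same length `n ≥ 1` with equal
`w`-weight enumerators have right dual codes with equal `w`-weight enumerators. -/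
def RespectsDuality {R : Type*} [Ring R] [Fintype R] (w : R → ℕ) : Prop :=
  ∀ n : ℕ, 1 ≤ n → ∀ C D : Submodule R (Fin n → R),
    weightEnumerator w (C : Set (Fin n → R)) = weightEnumerator w (D : Set (Fin n → R)) →
    weightEnumerator w (rightDual C : Set (Fin n → R)) =
      weightEnumerator w (rightDual D : Set (Fin n → R))

/-!
Let `q = |F|`. A homogeneous weight on `M_k(F)` is `ζ (1 - c (rank r))`, where `c` is `rankCoeff`
(`IsHomogeneousWeight.exists_eq_rankCoeff`). Indeed, adding to a matrix all rank-one matrices along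
a fixed nonzero row or column makes `c (rank ·)` sum to zero, so this function has the required
averages, and the averages determine a weight by induction on the rank. Two consequences are used.

* For `(k, q) ≠ (2, 2)`, the weight `w₁` of rank-one matrices is taken at no other rank and is less
  than twice any nonzero weight. Hence a vector has weight `w₁` iff it has a single nonzero entry,
  of rank one.
* For a subspace `U` of `F ^ m`, the sum of `w (x l)` over all matrices `l` with columns in `U` is
  `ζ |U| ^ k` if `x` does not annihilate `U`, and `0` otherwise (`sum_weight_mul_ofColumns`).

A finite family of subspaces `U i` of `F ^ m` therefore defines a code: the information words are the
`k × m` matrices `x`, and the coordinates are the products `x l` for all `i` and all `l` with columns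
in `U i`. The weight of `x` is `ζ ∑ |U i| ^ k`, over those `i` for which `x` does not annihilate
`U i`, and the dual contains a multiple of `∑ |U i| ^ (k - 1)` vectors of weight `w₁`. With
`m = k + 2`, compare `q ^ k + 1` distinct hyperplanes with the whole space together with `q ^ k`
copies of a subspace of codimension two. In both cases the lengths agree, the nonzero words have the
same two weights, and the smaller one is taken `(q ^ k + 1) (q ^ k - 1) = q ^ (2 k) - 1` times, so
the weight enumerators agree; but the sums `∑ |U i| ^ (k - 1)` differ.

For `(k, q) = (2, 2)`, the weight is a multiple of the Bachoc weight, which behaves under the Fourier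
transform of `M₂(𝔽₂)` like the Hamming weight on `𝔽₄ ^ 2`. This yields a MacWilliams identity
(`card_mul_sum_rightDual`), by which the weight enumerator of a code determines that of its dual.
-/

open Matrix Module

/-! ### The rank coefficients -/

/-- The normalised character sums `c i` that govern the homogeneous weight of `M_k(𝔽_q)`:
`c 0 = 1` and `(q ^ (k - i) - 1) c (i + 1) = -c i`, so that
`c i = (-1) ^ i / ∏_{j < i} (q ^ (k - j) - 1)`. The subtraction `k - i` is only used for `i < k`. -/
noncomputable def rankCoeff (q k : ℕ) : ℕ → ℝ
  | 0 => 1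
  | i + 1 => -rankCoeff q k i / ((q : ℝ) ^ (k - i) - 1)

/-- The recursion for `rankCoeff`, cleared of denominators: among the `q ^ k` ways to append a
column to a matrix of rank `i < k`, exactly `q ^ i` keep the rank. -/
theorem pow_mul_rankCoeff_add {q k i : ℕ} (hq : 1 < q) (hi : i < k) :
    (q : ℝ) ^ i * rankCoeff q k i + ((q : ℝ) ^ k - (q : ℝ) ^ i) * rankCoeff q k (i + 1) = 0 := by
  have h1 : (1 : ℝ) < (q : ℝ) ^ (k - i) :=
    one_lt_pow₀ (by exact_mod_cast hq) (by omega)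
  have h2 : (q : ℝ) ^ k = (q : ℝ) ^ i * (q : ℝ) ^ (k - i) := by
    rw [← pow_add]; congr 1; omega
  have h3 : (q : ℝ) ^ (k - i) - 1 ≠ 0 := by linarith
  rw [rankCoeff, h2]
  field_simp
  ring

/-! ### Ranks of rank-one updates -/

section RankOneUpdate

variable {F : Type*} [Field F] {k : ℕ}

theorem range_add_vecMulVec (A : Matrix (Fin k) (Fin k) F) (ψ v y : Fin k → F)
    (hv : ψ ⬝ᵥ v = 1) :
    LinearMap.range (A + vecMulVec y ψ).mulVecLin =
      (LinearMap.ker (dotProductBilin F F ψ)).map A.mulVecLin ⊔ Submodule.span F {A *ᵥ v + y} := by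
  have happ : ∀ u, (A + vecMulVec y ψ) *ᵥ u = A *ᵥ u + (ψ ⬝ᵥ u) • y := by
    intro u
    rw [add_mulVec, vecMulVec_mulVec]
    ext i; simp [mul_comm]
  apply le_antisymm
  · rintro _ ⟨u, rfl⟩
    have hdecomp : (A + vecMulVec y ψ).mulVecLin u =
        A *ᵥ (u - (ψ ⬝ᵥ u) • v) + (ψ ⬝ᵥ u) • (A *ᵥ v + y) := by
      rw [mulVecLin_apply, happ, mulVec_sub, mulVec_smul, smul_add]
      abel
    rw [hdecomp]
    refine Submodule.add_mem_sup ⟨u - (ψ ⬝ᵥ u) • v, ?_, rfl⟩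
      (Submodule.smul_mem _ _ (Submodule.mem_span_singleton_self _))
    simp [dotProduct_sub, dotProduct_smul, hv]
  · refine sup_le ?_ ?_
    · rintro _ ⟨u, hu, rfl⟩
      refine ⟨u, ?_⟩
      have hu' : ψ ⬝ᵥ u = 0 := hu
      rw [mulVecLin_apply, happ, hu', zero_smul, add_zero, mulVecLin_apply]
    · rw [Submodule.span_singleton_le_iff_mem]
      exact ⟨v, by rw [mulVecLin_apply, happ, hv, one_smul]⟩

variable [Fintype F]

open Classical in
/-- Summed over all rank-one updates of a fixed matrix along a fixed nonzero row vector, `rankCoeff`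
of the rank vanishes: on the kernel of `ψ` the update is invisible, and a vector outside this kernel
is sent to a uniformly distributed vector. -/
theorem sum_rankCoeff_add_vecMulVec (A : Matrix (Fin k) (Fin k) F) {ψ : Fin k → F} (hψ : ψ ≠ 0) :
    ∑ y : Fin k → F, rankCoeff (Fintype.card F) k (A + vecMulVec y ψ).rank = 0 := by
  obtain ⟨v, hv⟩ : ∃ v, ψ ⬝ᵥ v = 1 := by
    obtain ⟨j, hj⟩ := Function.ne_iff.mp hψ
    exact ⟨Pi.single j (ψ j)⁻¹, by simpa using mul_inv_cancel₀ hj⟩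
  set p : Dual F (Fin k → F) := dotProductBilin F F ψ with hp
  set W := (LinearMap.ker p).map A.mulVecLin with hW
  set i := finrank F W with hi
  have hp0 : p ≠ 0 := fun h => by
    have : p v = 0 := by rw [h]; rfl
    exact one_ne_zero (hv.symm.trans this)
  have hik : i < k := by
    have h1 := Dual.finrank_ker_add_one_of_ne_zero hp0
    have h2 : i ≤ finrank F (LinearMap.ker p) := Submodule.finrank_map_le A.mulVecLin _
    rw [finrank_fin_fun] at h1
    omega
  have hrank : ∀ y, (A + vecMulVec y ψ).rank = if A *ᵥ v + y ∈ W then i else i + 1 := by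
    intro y
    rw [Matrix.rank, range_add_vecMulVec A ψ v y hv]
    split_ifs with h
    · rw [sup_eq_left.mpr ((Submodule.span_singleton_le_iff_mem _ _).mpr h)]
    · rw [Submodule.finrank_sup_span_singleton h]
  have hcard : (Finset.univ.filter (fun z : Fin k → F => z ∈ W)).card = Fintype.card F ^ i := by
    rw [← Fintype.card_subtype]
    exact Module.card_eq_pow_finrank (K := F) (V := W)
  have hcard' : ((Finset.univ.filter (fun z : Fin k → F => z ∉ W)).card : ℝ) =
      (Fintype.card F : ℝ) ^ k - (Fintype.card F : ℝ) ^ i := by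
    have := Finset.card_filter_add_card_filter_not (s := Finset.univ)
      (fun z : Fin k → F => z ∈ W)
    rw [hcard, Finset.card_univ, Fintype.card_fun, Fintype.card_fin] at this
    rw [eq_sub_iff_add_eq']
    exact_mod_cast this
  simp_rw [hrank]
  refine (Equiv.sum_comp (Equiv.addLeft (A *ᵥ v))
    (fun z => rankCoeff (Fintype.card F) k (if z ∈ W then i else i + 1))).trans ?_
  simp_rw [apply_ite (rankCoeff (Fintype.card F) k)]
  rw [Finset.sum_ite, Finset.sum_const, Finset.sum_const, nsmul_eq_mul, nsmul_eq_mul, hcard,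
    hcard', Nat.cast_pow]
  exact pow_mul_rankCoeff_add Fintype.one_lt_card hik

theorem sum_rankCoeff_add_vecMulVec' (A : Matrix (Fin k) (Fin k) F) {v : Fin k → F} (hv : v ≠ 0) :
    ∑ φ : Fin k → F, rankCoeff (Fintype.card F) k (A + vecMulVec v φ).rank = 0 := by
  rw [← sum_rankCoeff_add_vecMulVec Aᵀ hv]
  refine Finset.sum_congr rfl fun φ _ => ?_
  rw [← rank_transpose, transpose_add, transpose_vecMulVec]

/-- A function on a finite group sums to zero if its sums over all translates of some nonempty
family do. -/
theorem sum_eq_zero_of_forall_sum_translate {G Y : Type*} [AddGroup G] [Fintype G] [Fintype Y]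
    [Nonempty Y] (t : Y → G) (f : G → ℝ) (h : ∀ g, ∑ y, f (g + t y) = 0) : ∑ g, f g = 0 := by
  have h1 : ∑ y : Y, ∑ g, f (g + t y) = Fintype.card Y * ∑ g, f g := by
    refine (Finset.sum_congr rfl fun y _ => Equiv.sum_comp (Equiv.addRight (t y)) f).trans ?_
    rw [Finset.sum_const, nsmul_eq_mul, Finset.card_univ]
  rw [Finset.sum_comm, Finset.sum_congr rfl fun g _ => h g, Finset.sum_const_zero] at h1
  have : (Fintype.card Y : ℝ) ≠ 0 := by exact_mod_cast Fintype.card_ne_zero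
  exact (mul_eq_zero.mp h1.symm).resolve_left this

end RankOneUpdate

/-! ### Uniqueness of the homogeneous weight -/

section Uniqueness

variable {F : Type*} [Field F] {k : ℕ}

/-- Left multiples of `r` of the same rank as `r` are unit multiples of `r`. -/
theorem exists_unit_mul_eq_of_rank_eq (a r : Matrix (Fin k) (Fin k) F)
    (h : (a * r).rank = r.rank) :
    ∃ u : (Matrix (Fin k) (Fin k) F)ˣ, (u : Matrix _ _ F) * r = a * r := by
  -- `a` is injective on the column space of `r`, so its restriction extends to an automorphism.
  set W := LinearMap.range r.mulVecLin
  set g : W →ₗ[F] (Fin k → F) := a.mulVecLin.domRestrict W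
  have hg : Function.Injective g := by
    rw [← LinearMap.ker_eq_bot, ← Submodule.finrank_eq_zero (R := F)]
    have h1 := LinearMap.finrank_range_add_finrank_ker g
    have h2 : LinearMap.range g = LinearMap.range (a * r).mulVecLin := by
      rw [mulVecLin_mul, LinearMap.range_comp, LinearMap.range_domRestrict]
    rw [h2] at h1
    change (a * r).rank + _ = r.rank at h1
    omega
  obtain ⟨e, he⟩ := Submodule.exists_linearEquiv_restrict_eq (LinearEquiv.ofInjective g hg)
  have hu : IsUnit (LinearMap.toMatrix' e.toLinearMap) := by
    rw [LinearMap.isUnit_toMatrix'_iff]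
    exact (LinearMap.isUnit_iff_ker_eq_bot _).mpr e.ker
  refine ⟨hu.unit, ?_⟩
  rw [IsUnit.unit_spec]
  apply Matrix.toLin'.injective
  ext1 j
  ext1
  have := he ⟨r *ᵥ Pi.single j 1, ⟨Pi.single j 1, rfl⟩⟩
  simpa [toLin'_mul, g] using this.symm

variable [Fintype F]

/-- The sum of `rankCoeff` of the rank over a nonzero principal left ideal vanishes: the ideal is
closed under rank-one updates along a nonzero row of its generator. -/
theorem sum_rankCoeff_span {r : Matrix (Fin k) (Fin k) F} (hr : r ≠ 0) :
    ∑ᶠ x ∈ (Ideal.span {r} : Ideal (Matrix (Fin k) (Fin k) F)),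
      rankCoeff (Fintype.card F) k x.rank = 0 := by
  classical
  obtain ⟨i, hi⟩ := Function.ne_iff.mp hr
  have hmem : ∀ y : Fin k → F, vecMulVec y (r i) ∈
      (Ideal.span {r} : Ideal (Matrix (Fin k) (Fin k) F)) := by
    intro y
    refine Ideal.mem_span_singleton'.mpr ⟨vecMulVec y (Pi.single i 1), ?_⟩
    rw [vecMulVec_mul, single_one_vecMul]
    rfl
  have := Fintype.ofFinite (Ideal.span {r} : Ideal (Matrix (Fin k) (Fin k) F))
  have h := finsum_set_coe_eq_finsum_mem (f := fun x : Matrix (Fin k) (Fin k) F =>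
    rankCoeff (Fintype.card F) k x.rank) (Ideal.span {r} : Ideal (Matrix (Fin k) (Fin k) F))
  refine Eq.trans h.symm ?_
  refine (finsum_eq_sum_of_fintype _).trans ?_
  refine sum_eq_zero_of_forall_sum_translate
    (G := (Ideal.span {r} : Ideal (Matrix (Fin k) (Fin k) F)))
    (fun y : Fin k → F => ⟨vecMulVec y (r i), hmem y⟩) _ fun g => ?_
  exact sum_rankCoeff_add_vecMulVec _ hi

/-- A homogeneous weight on `M_k(𝔽_q)` is determined by its average `ζ`: at a matrix `r` it is
`ζ (1 - c (rank r))`. Both functions have the same sums over principal left ideals, and the elements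
of `R r` that have the rank of `r` are unit multiples of `r`, so induction on the rank applies. -/
theorem IsHomogeneousWeight.exists_eq_rankCoeff {w : Matrix (Fin k) (Fin k) F → ℝ}
    (hw : IsHomogeneousWeight w) :
    ∃ ζ : ℝ, 0 < ζ ∧ ∀ r, w r = ζ * (1 - rankCoeff (Fintype.card F) k r.rank) := by
  classical
  obtain ⟨h0, hu, ζ, hζ, hsum⟩ := hw
  refine ⟨ζ, hζ, ?_⟩
  suffices H : ∀ d : ℕ, ∀ r : Matrix (Fin k) (Fin k) F, r.rank = d →
      w r = ζ * (1 - rankCoeff (Fintype.card F) k r.rank) from fun r => H _ r rfl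
  intro d
  induction d using Nat.strong_induction_on with
  | _ d ih =>
  intro r hrd
  by_cases hr : r = 0
  · simp [hr, h0, rankCoeff]
  set I : Ideal (Matrix (Fin k) (Fin k) F) := Ideal.span {r} with hI
  have := Fintype.ofFinite I
  have hf : ∀ f : Matrix (Fin k) (Fin k) F → ℝ, ∑ᶠ x ∈ I, f x = ∑ x : I, f x := fun f =>
    (finsum_set_coe_eq_finsum_mem (f := f) (I : Set (Matrix (Fin k) (Fin k) F))).symm.trans
      (finsum_eq_sum_of_fintype _)
  have hs := hsum r hr
  have hc := sum_rankCoeff_span hr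
  rw [← hI, hf] at hs hc
  rw [Nat.card_eq_fintype_card] at hs
  have hdiff : ∑ x : I,
      (w x - ζ * (1 - rankCoeff (Fintype.card F) k (x : Matrix (Fin k) (Fin k) F).rank)) =
      0 := by
    rw [Finset.sum_sub_distrib, hs, ← Finset.mul_sum, Finset.sum_sub_distrib, hc]
    simp
  have hterm : ∀ x : I,
      w x - ζ * (1 - rankCoeff (Fintype.card F) k (x : Matrix (Fin k) (Fin k) F).rank) =
      if (x : Matrix (Fin k) (Fin k) F).rank = d then
        w r - ζ * (1 - rankCoeff (Fintype.card F) k r.rank) else 0 := by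
    rintro ⟨x, hx⟩
    obtain ⟨a, rfl⟩ := Ideal.mem_span_singleton'.mp hx
    have hle : (a * r).rank ≤ d := hrd ▸ rank_mul_le_right a r
    split_ifs with h
    · obtain ⟨u, hu'⟩ := exists_unit_mul_eq_of_rank_eq a r (h.trans hrd.symm)
      dsimp only at h ⊢
      rw [h, hrd, ← hu', hu]
    · rw [ih _ (lt_of_le_of_ne hle h) _ rfl, sub_self]
  rw [Finset.sum_congr rfl fun x _ => hterm x, ← Finset.sum_filter, Finset.sum_const,
    nsmul_eq_mul, mul_eq_zero, sub_eq_zero] at hdiff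
  refine hdiff.resolve_left ?_
  have hrI : r ∈ I := Ideal.mem_span_singleton_self r
  have hmem : (⟨r, hrI⟩ : I) ∈
      Finset.univ.filter fun x : I => (x : Matrix (Fin k) (Fin k) F).rank = d := by
    rw [Finset.mem_filter]
    exact ⟨Finset.mem_univ _, hrd⟩
  exact Nat.cast_ne_zero.mpr (Finset.card_ne_zero_of_mem hmem)

end Uniqueness

/-! ### Numerical inequalities for the rank coefficients -/

section Values

variable {q k : ℕ}

theorem rankCoeff_one (q k : ℕ) : rankCoeff q k 1 = -(1 / ((q : ℝ) ^ k - 1)) := by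
  simp [rankCoeff, neg_div]

theorem rankCoeff_two (q k : ℕ) :
    rankCoeff q k 2 = 1 / (((q : ℝ) ^ k - 1) * ((q : ℝ) ^ (k - 1) - 1)) := by
  rw [rankCoeff, rankCoeff_one, neg_neg, div_div]

theorem abs_rankCoeff_succ_le (hq : 1 < q) {i : ℕ} (hi : i < k) :
    |rankCoeff q k (i + 1)| ≤ |rankCoeff q k i| := by
  have h2 : (2 : ℝ) ≤ (q : ℝ) ^ (k - i) := by
    have : 2 ≤ q ^ (k - i) :=
      (Nat.succ_le_of_lt hq).trans (Nat.le_self_pow (Nat.sub_ne_zero_of_lt hi) q)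
    exact_mod_cast this
  have h3 : (1 : ℝ) ≤ (q : ℝ) ^ (k - i) - 1 := by linarith
  rw [rankCoeff, abs_div, abs_neg, abs_of_pos (a := (q : ℝ) ^ (k - i) - 1) (by linarith)]
  exact div_le_self (abs_nonneg _) h3

theorem abs_rankCoeff_le_rankCoeff_two (hq : 1 < q) {i : ℕ} (hi : 2 ≤ i) (hik : i ≤ k) :
    |rankCoeff q k i| ≤ rankCoeff q k 2 := by
  induction i, hi using Nat.le_induction with
  | base =>
    have h1 : (1 : ℝ) ≤ (q : ℝ) ^ k := one_le_pow₀ (by exact_mod_cast hq.le)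
    have h2 : (1 : ℝ) ≤ (q : ℝ) ^ (k - 1) := one_le_pow₀ (by exact_mod_cast hq.le)
    refine (abs_of_nonneg ?_).le
    rw [rankCoeff_two]
    exact one_div_nonneg.mpr (mul_nonneg (by linarith) (by linarith))
  | succ j hj ih => exact (abs_rankCoeff_succ_le hq (by omega)).trans (ih (by omega))

/-- The two numerical inequalities that exclude `(k, q) = (2, 2)`, where both are equalities: there
the last factor `q ^ (k - 1) - 1` is `1` and `q ^ k - 1` is `3`. -/
theorem rankCoeff_two_lt (hq : 1 < q) (hk : 2 ≤ k) (h : ¬(k = 2 ∧ q = 2)) :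
    rankCoeff q k 2 < -rankCoeff q k 1 ∧ -rankCoeff q k 1 + 2 * rankCoeff q k 2 < 1 := by
  have hB' : 3 ≤ q ^ (k - 1) := by
    rcases eq_or_lt_of_le hk with rfl | hk'
    · simp; omega
    · calc 3 ≤ 2 ^ 2 := by norm_num
        _ ≤ q ^ 2 := Nat.pow_le_pow_left hq 2
        _ ≤ q ^ (k - 1) := Nat.pow_le_pow_right (by omega) (by omega)
  have hA' : 2 * q ^ (k - 1) ≤ q ^ k := by
    obtain ⟨j, rfl⟩ : ∃ j, k = j + 1 := ⟨k - 1, by omega⟩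
    rw [Nat.add_sub_cancel, pow_succ, mul_comm]
    exact Nat.mul_le_mul_left _ hq
  have hB : (2 : ℝ) ≤ (q : ℝ) ^ (k - 1) - 1 := by
    have : (3 : ℝ) ≤ (q : ℝ) ^ (k - 1) := by exact_mod_cast hB'
    linarith
  have hA : (5 : ℝ) ≤ (q : ℝ) ^ k - 1 := by
    have : 2 * (q : ℝ) ^ (k - 1) ≤ (q : ℝ) ^ k := by exact_mod_cast hA'
    linarith
  rw [rankCoeff_one, rankCoeff_two, neg_neg]
  set A := (q : ℝ) ^ k - 1
  set B := (q : ℝ) ^ (k - 1) - 1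
  constructor
  · apply one_div_lt_one_div_of_lt (by linarith)
    nlinarith
  · have h1 : 1 / A ≤ 1 / 5 := one_div_le_one_div_of_le (by norm_num) hA
    have h2 : 1 / (A * B) ≤ 1 / 10 := one_div_le_one_div_of_le (by norm_num) (by nlinarith)
    linarith

end Values

/-! ### Order of the values of a homogeneous weight -/

section WeightOrder

theorem rank_eq_zero_iff_eq_zero {F : Type*} [Field F] {k : ℕ} {m : Type*}
    {A : Matrix m (Fin k) F} : A.rank = 0 ↔ A = 0 := by
  refine ⟨fun h => ?_, fun h => h ▸ rank_zero⟩
  have h1 : LinearMap.range A.mulVecLin = ⊥ := Submodule.finrank_eq_zero.mp h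
  have h2 : A.mulVecLin = 0 := LinearMap.range_eq_bot.mp h1
  ext i j
  simpa using congrFun (LinearMap.congr_fun h2 (Pi.single j 1)) i

variable {F : Type*} [Field F] [Fintype F] {k : ℕ} {w : Matrix (Fin k) (Fin k) F → ℕ}

/-- The order relations between the values of an integer-valued homogeneous weight: the weight of
rank-one matrices is taken at no other rank, and it is less than twice any other nonzero value. -/
theorem IsHomogeneousWeight.lt_two_mul_and_eq_iff (hk : 2 ≤ k) (h22 : ¬(k = 2 ∧ Fintype.card F = 2))
    (hw : IsHomogeneousWeight fun r => (w r : ℝ)) {r₁ r : Matrix (Fin k) (Fin k) F}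
    (h₁ : r₁.rank = 1) (hr : r ≠ 0) :
    w r₁ < 2 * w r ∧ (w r = w r₁ ↔ r.rank = 1) ∧ w r ≤ w r₁ := by
  obtain ⟨ζ, hζ, hval⟩ := hw.exists_eq_rankCoeff
  obtain ⟨ha, hb⟩ := rankCoeff_two_lt Fintype.one_lt_card hk h22
  have hv1 := hval r₁
  have hvr := hval r
  rw [h₁] at hv1
  by_cases hr1 : r.rank = 1
  · have heq : (w r : ℝ) = w r₁ := by rw [hvr, hv1, hr1]
    have heq' : w r = w r₁ := by exact_mod_cast heq
    have hc1 : rankCoeff (Fintype.card F) k 1 ≤ 0 := by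
      rw [rankCoeff_one, neg_nonpos]
      exact one_div_nonneg.mpr (sub_nonneg.mpr
        (one_le_pow₀ (by exact_mod_cast Fintype.one_lt_card.le)))
    have hpos : (0 : ℝ) < w r₁ := by
      rw [hv1]; exact mul_pos hζ (by linarith)
    have hpos' : 0 < w r₁ := by exact_mod_cast hpos
    exact ⟨by omega, by simp [heq', hr1], heq'.le⟩
  · have hr2 : 2 ≤ r.rank := by
      have := rank_eq_zero_iff_eq_zero.not.mpr hr
      omega
    have hle := abs_le.mp (abs_rankCoeff_le_rankCoeff_two (q := Fintype.card F)
      Fintype.one_lt_card hr2 (rank_le_width r))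
    have h1 : (w r : ℝ) < w r₁ := by
      rw [hvr, hv1]
      exact mul_lt_mul_of_pos_left (by linarith) hζ
    have h2 : (w r₁ : ℝ) < 2 * w r := by
      rw [hvr, hv1, mul_left_comm]
      exact mul_lt_mul_of_pos_left (by linarith) hζ
    have h1' : w r < w r₁ := by exact_mod_cast h1
    have h2' : w r₁ < 2 * w r := by exact_mod_cast h2
    exact ⟨h2', iff_of_false h1'.ne hr1, h1'.le⟩

end WeightOrder

/-! ### Sums over matrices with columns in a subspace -/

section ColumnSums

variable {F : Type*} [Field F] {k : ℕ} {m : Type*}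

/-- The matrix whose `j`-th column is `l j`. -/
def ofColumns {U : Submodule F (m → F)} (l : Fin k → U) : Matrix m (Fin k) F :=
  Matrix.of fun i j => (l j : m → F) i

variable [Fintype F] [Fintype m]

open Classical in
/-- Over all matrices `l` whose columns lie in a subspace `U`, the homogeneous weight of `x * l` has
the average `ζ`, unless `x` annihilates `U`: replacing `l` by its translates by `u ⊗ φ`, with a fixed
`u ∈ U` that `x` does not annihilate, averages `rankCoeff` to zero. -/
theorem sum_weight_mul_ofColumns {w : Matrix (Fin k) (Fin k) F → ℕ} {ζ : ℝ}
    (hval : ∀ r, (w r : ℝ) = ζ * (1 - rankCoeff (Fintype.card F) k r.rank))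
    (U : Submodule F (m → F)) (x : Matrix (Fin k) m F) :
    ∑ l : Fin k → U, (w (x * ofColumns l) : ℝ) =
      if ∃ u ∈ U, x *ᵥ u ≠ 0 then ζ * (Nat.card U : ℝ) ^ k else 0 := by
  rw [Nat.card_eq_fintype_card]
  have hmul : ∀ (l : Fin k → U) i j, (x * ofColumns l) i j = (x *ᵥ (l j : m → F)) i :=
    fun _ _ _ => rfl
  split_ifs with h
  · obtain ⟨u, hu, hxu⟩ := h
    have hz : ∑ l : Fin k → U, rankCoeff (Fintype.card F) k (x * ofColumns l).rank = 0 := by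
      refine sum_eq_zero_of_forall_sum_translate
        (fun φ : Fin k → F => fun j => φ j • (⟨u, hu⟩ : U)) _ fun l => ?_
      rw [← sum_rankCoeff_add_vecMulVec' (x * ofColumns l) hxu]
      refine Finset.sum_congr rfl fun φ _ => ?_
      congr 2
      ext i j
      simp [hmul, mulVec_add, mulVec_smul, vecMulVec_apply, mul_comm]
    simp_rw [hval]
    rw [← Finset.mul_sum, Finset.sum_sub_distrib, hz]
    simp
  · push Not at h
    refine Finset.sum_eq_zero fun l _ => ?_
    have : x * ofColumns l = 0 := by
      ext i j
      rw [hmul, h _ (l j).2]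
      rfl
    simp [hval, this, rankCoeff]

end ColumnSums

/-! ### Weight enumerators and weight counts -/

section Enumerator

theorem sum_comp_vecWeight_eq_sum_weightCount {R : Type*} [Fintype R] (w : R → ℕ) {n : ℕ}
    {A : Type*} [AddCommMonoid A] (f : ℕ → A) (C : Set (Fin n → R)) [DecidablePred (· ∈ C)] :
    ∑ x : Fin n → R with x ∈ C, f (vecWeight w x) =
      ∑ j ∈ Finset.univ.image (vecWeight w (n := n)), weightCount w j C • f j := by
  have hcount : ∀ j, weightCount w j C =
      ((Finset.univ.filter fun x : Fin n → R => x ∈ C).filter fun x => vecWeight w x = j).card := by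
    intro j
    rw [weightCount, ← Set.ncard_coe_finset]
    congr 1
    ext x
    simp
  rw [← Finset.sum_fiberwise_of_maps_to (g := vecWeight w)
    (fun x _ => Finset.mem_image_of_mem (vecWeight w) (Finset.mem_univ x))]
  refine Finset.sum_congr rfl fun j _ => ?_
  rw [hcount, ← Finset.sum_const]
  exact Finset.sum_congr rfl fun x hx => by rw [(Finset.mem_filter.mp hx).2]

open Classical in
theorem coeff_weightEnumerator {R : Type*} [Fintype R] (w : R → ℕ) {n : ℕ} (C : Set (Fin n → R))
    (j : ℕ) :
    (weightEnumerator w C).coeff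
      (Finsupp.single 0 (n * maxWeight w - j) + Finsupp.single 1 j) = weightCount w j C := by
  rw [weightEnumerator, MvPolynomial.coeff_sum]
  have h : ∀ x : Fin n → R, MvPolynomial.coeff
      (Finsupp.single 0 (n * maxWeight w - j) + Finsupp.single 1 j)
      ((MvPolynomial.X 0 ^ (n * maxWeight w - vecWeight w x) * MvPolynomial.X 1 ^ vecWeight w x :
        MvPolynomial (Fin 2) ℤ)) = if vecWeight w x = j then 1 else 0 := by
    intro x
    rw [MvPolynomial.X_pow_eq_monomial, MvPolynomial.X_pow_eq_monomial, MvPolynomial.monomial_mul,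
      one_mul, MvPolynomial.coeff_monomial]
    refine if_congr ⟨fun h => ?_, fun h => by rw [h]⟩ rfl rfl
    simpa using DFunLike.congr_fun h 1
  rw [Finset.sum_congr rfl fun x _ => h x, ← Finset.sum_filter, Finset.sum_const, weightCount,
    ← Set.ncard_coe_finset]
  simp

theorem weightCount_eq_of_weightEnumerator_eq {R : Type*} [Fintype R] {w : R → ℕ} {n : ℕ}
    {C D : Set (Fin n → R)} (h : weightEnumerator w C = weightEnumerator w D) (j : ℕ) :
    weightCount w j C = weightCount w j D := by
  have := coeff_weightEnumerator w C j
  rw [h, coeff_weightEnumerator] at this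
  exact_mod_cast this.symm

/-- Codes with equal weight enumerators have equal sums of any function of the weight. -/
theorem sum_comp_vecWeight_eq_of_weightEnumerator_eq {R : Type*} [Fintype R] {w : R → ℕ} {n : ℕ}
    {C D : Set (Fin n → R)} [DecidablePred (· ∈ C)] [DecidablePred (· ∈ D)]
    (h : weightEnumerator w C = weightEnumerator w D) {A : Type*}
    [AddCommMonoid A] (f : ℕ → A) :
    ∑ x : Fin n → R with x ∈ C, f (vecWeight w x) =
      ∑ x : Fin n → R with x ∈ D, f (vecWeight w x) := by
  rw [sum_comp_vecWeight_eq_sum_weightCount, sum_comp_vecWeight_eq_sum_weightCount]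
  exact Finset.sum_congr rfl fun j _ => by rw [weightCount_eq_of_weightEnumerator_eq h]

end Enumerator

/-! ### Codes given by generator matrices -/

section GeneratorCode

variable {F : Type*} [Field F] {k n : ℕ} {m : Type*} [Fintype m]

/-- The left linear code `{(x Λ₁, …, x Λₙ)}` with generator matrices `Λ`, where the information
words `x` are the `k × m` matrices. -/
def generatorCode (Λ : Fin n → Matrix m (Fin k) F) :
    Submodule (Matrix (Fin k) (Fin k) F) (Fin n → Matrix (Fin k) (Fin k) F) where
  carrier := Set.range fun (x : Matrix (Fin k) m F) j => x * Λ j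
  zero_mem' := ⟨0, by ext; simp⟩
  add_mem' := by
    rintro _ _ ⟨x, rfl⟩ ⟨y, rfl⟩
    exact ⟨x + y, by funext j; simp [Matrix.add_mul]⟩
  smul_mem' := by
    rintro r _ ⟨x, rfl⟩
    exact ⟨r * x, by funext j; simp [Matrix.mul_assoc]⟩

/-- The dual of the code generated by `Λ` is the right kernel of `Λ`. -/
theorem mem_rightDual_generatorCode (hk : 0 < k) (Λ : Fin n → Matrix m (Fin k) F)
    (y : Fin n → Matrix (Fin k) (Fin k) F) :
    y ∈ rightDual (generatorCode Λ) ↔ ∑ j, Λ j * y j = 0 := by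
  classical
  have hsum : ∀ x : Matrix (Fin k) m F, ∑ j, x * Λ j * y j = x * ∑ j, Λ j * y j := fun x => by
    rw [Matrix.mul_sum]
    exact Finset.sum_congr rfl fun j _ => Matrix.mul_assoc _ _ _
  constructor
  · intro h
    ext a b
    have := h _ ⟨Matrix.single ⟨0, hk⟩ a 1, rfl⟩
    rw [hsum] at this
    simpa using congrFun (congrFun this ⟨0, hk⟩) b
  · rintro h _ ⟨x, rfl⟩
    rw [hsum, h, Matrix.mul_zero]

variable [Fintype F]

open Classical in
theorem weightEnumerator_generatorCode (w : Matrix (Fin k) (Fin k) F → ℕ) (hw0 : w 0 = 0)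
    (Λ : Fin n → Matrix m (Fin k) F)
    (hpos : ∀ x : Matrix (Fin k) m F, x ≠ 0 → vecWeight w (fun j => x * Λ j) ≠ 0) :
    weightEnumerator w (generatorCode Λ : Set (Fin n → Matrix (Fin k) (Fin k) F)) =
      ∑ x : Matrix (Fin k) m F,
        MvPolynomial.X 0 ^ (n * maxWeight w - vecWeight w fun j => x * Λ j) *
          MvPolynomial.X 1 ^ vecWeight w fun j => x * Λ j := by
  have hinj : Function.Injective fun (x : Matrix (Fin k) m F) j => x * Λ j := by
    intro x y hxy
    by_contra hne
    refine hpos (x - y) (sub_ne_zero.mpr hne) ?_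
    have : ∀ j, (x - y) * Λ j = 0 := fun j => by
      rw [Matrix.sub_mul, sub_eq_zero]
      exact congrFun hxy j
    simp [vecWeight, this, hw0]
  have himage : (Finset.univ.filter fun x : Fin n → Matrix (Fin k) (Fin k) F =>
      x ∈ (generatorCode Λ : Set (Fin n → Matrix (Fin k) (Fin k) F))) =
      Finset.univ.image fun (x : Matrix (Fin k) m F) j => x * Λ j := by
    ext y
    rw [Finset.mem_filter, Finset.mem_image]
    exact ⟨fun ⟨_, x, hx⟩ => ⟨x, Finset.mem_univ _, hx⟩,
      fun ⟨x, _, hx⟩ => ⟨Finset.mem_univ _, x, hx⟩⟩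
  rw [weightEnumerator]
  convert Finset.sum_image (s := Finset.univ) (f := fun v =>
    (MvPolynomial.X 0 ^ (n * maxWeight w - vecWeight w v) * MvPolynomial.X 1 ^ vecWeight w v :
      MvPolynomial (Fin 2) ℤ)) (fun x _ y _ h => hinj h) using 2

open Classical in
/-- Two codes whose nonzero words have two nonzero weights `α` and `β`, with equal numbers of words
of weight `α`, have the same weight enumerator. -/
theorem weightEnumerator_generatorCode_eq (w : Matrix (Fin k) (Fin k) F → ℕ) (hw0 : w 0 = 0)
    (Λ Λ' : Fin n → Matrix m (Fin k) F) {α β : ℝ} (hα : α ≠ 0) (hβ : β ≠ 0)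
    (B B' : Finset (Matrix (Fin k) m F)) (hB : 0 ∉ B) (hB' : 0 ∉ B') (hcard : B.card = B'.card)
    (hΛ : ∀ x, (vecWeight w (fun j => x * Λ j) : ℝ) = if x = 0 then 0 else if x ∈ B then α else β)
    (hΛ' : ∀ x, (vecWeight w (fun j => x * Λ' j) : ℝ) =
      if x = 0 then 0 else if x ∈ B' then α else β) :
    weightEnumerator w (generatorCode Λ : Set (Fin n → Matrix (Fin k) (Fin k) F)) =
      weightEnumerator w (generatorCode Λ' : Set (Fin n → Matrix (Fin k) (Fin k) F)) := by
  have key : ∀ (Λ : Fin n → Matrix m (Fin k) F) (B : Finset (Matrix (Fin k) m F)), 0 ∉ B →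
      (∀ x, (vecWeight w (fun j => x * Λ j) : ℝ) =
        if x = 0 then 0 else if x ∈ B then α else β) →
      weightEnumerator w (generatorCode Λ : Set (Fin n → Matrix (Fin k) (Fin k) F)) =
        ∑ x : Matrix (Fin k) m F, (fun t : ℝ =>
          (MvPolynomial.X 0 ^ (n * maxWeight w - ⌊t⌋₊) * MvPolynomial.X 1 ^ ⌊t⌋₊ :
            MvPolynomial (Fin 2) ℤ)) (if x = 0 then 0 else if x ∈ B then α else β) := by
    intro Λ B hB h
    rw [weightEnumerator_generatorCode w hw0]
    · refine Finset.sum_congr rfl fun x _ => ?_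
      rw [← h x]
      simp only [Nat.floor_natCast]
    · intro x hx h0
      have := h x
      rw [h0, if_neg hx] at this
      split_ifs at this
      · exact hα (by simpa using this.symm)
      · exact hβ (by simpa using this.symm)
  rw [key Λ B hB hΛ, key Λ' B' hB' hΛ']
  -- the monomial of a weight, as a function of a real number since `α` and `β` are real
  generalize (fun t : ℝ =>
    (MvPolynomial.X 0 ^ (n * maxWeight w - ⌊t⌋₊) * MvPolynomial.X 1 ^ ⌊t⌋₊ :
      MvPolynomial (Fin 2) ℤ)) = g
  have hsplit : ∀ B : Finset (Matrix (Fin k) m F), 0 ∉ B →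
      ∑ x, g (if x = 0 then 0 else if x ∈ B then α else β) =
        g 0 + B.card • g α + (Fintype.card (Matrix (Fin k) m F) - (B.card + 1)) • g β := by
    intro B hB
    have h1 : ∑ x ∈ insert 0 B, g (if x = 0 then 0 else if x ∈ B then α else β) =
        g 0 + B.card • g α := by
      rw [Finset.sum_insert hB, if_pos rfl, ← Finset.sum_const]
      congr 1
      refine Finset.sum_congr rfl fun x hx => ?_
      rw [if_neg (fun h : x = 0 => hB (h ▸ hx)), if_pos hx]
    have h2 : ∑ x ∈ (insert 0 B)ᶜ, g (if x = 0 then 0 else if x ∈ B then α else β) =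
        (Fintype.card (Matrix (Fin k) m F) - (B.card + 1)) • g β := by
      rw [← Finset.card_insert_of_notMem hB, ← Finset.card_compl, ← Finset.sum_const]
      refine Finset.sum_congr rfl fun x hx => ?_
      rw [Finset.mem_compl, Finset.mem_insert, not_or] at hx
      rw [if_neg hx.1, if_neg hx.2]
    rw [← Finset.sum_add_sum_compl (insert 0 B), h1, h2]
  rw [hsplit B hB, hsplit B' hB', hcard]

end GeneratorCode

/-! ### Dual words with a single nonzero entry -/

section DualCount

variable {F : Type*} [Field F] {k n : ℕ} {m : Type*} [Fintype m] {w : Matrix (Fin k) (Fin k) F → ℕ}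

/-- If `2 w(r) > w₁` for all `r ≠ 0`, where `w₁` is the weight of exactly the matrices of rank one,
then the vectors of weight `w₁` are those with a single nonzero entry, of rank one. -/
theorem vecWeight_eq_iff_exists_single {w₁ : ℕ} (hw0 : w 0 = 0) (hw1 : w₁ ≠ 0)
    (hlt : ∀ r, r ≠ 0 → w₁ < 2 * w r) (heq : ∀ r, r ≠ 0 → (w r = w₁ ↔ r.rank = 1))
    (y : Fin n → Matrix (Fin k) (Fin k) F) :
    vecWeight w y = w₁ ↔
      ∃ j, ∃ r : Matrix (Fin k) (Fin k) F, r.rank = 1 ∧ y = Pi.single j r := by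
  have hne : ∀ r : Matrix (Fin k) (Fin k) F, r.rank = 1 → r ≠ 0 := fun r hr h => by
    rw [h, rank_zero] at hr
    exact zero_ne_one hr
  have hsingle : ∀ j r, vecWeight w (Pi.single j r : Fin n → Matrix (Fin k) (Fin k) F) = w r := by
    intro j r
    rw [vecWeight, Finset.sum_eq_single j, Pi.single_eq_same]
    · intro i _ hij
      rw [Pi.single_eq_of_ne hij, hw0]
    · simp
  constructor
  · intro h
    obtain ⟨j, hj⟩ : ∃ j, y j ≠ 0 := by
      by_contra! hall
      apply hw1
      simp [← h, vecWeight, hall, hw0]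
    have hy : y = Pi.single j (y j) := by
      funext i
      by_cases hij : i = j
      · rw [hij, Pi.single_eq_same]
      · rw [Pi.single_eq_of_ne hij]
        by_contra hi
        have h1 : w (y i) + w (y j) ≤ vecWeight w y := by
          rw [← Finset.sum_pair (f := fun i => w (y i)) hij]
          exact Finset.sum_le_sum_of_subset (Finset.subset_univ _)
        have h2 := hlt _ hi
        have h3 := hlt _ hj
        omega
    refine ⟨j, y j, ?_, hy⟩
    rw [hy, hsingle] at h
    exact (heq _ hj).mp h
  · rintro ⟨j, r, hr, rfl⟩
    rw [hsingle]
    exact (heq r (hne r hr)).mpr hr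

variable [Fintype F]

open Classical in
theorem weightCount_rightDual_generatorCode {w₁ : ℕ} (hk : 0 < k) (hw0 : w 0 = 0) (hw1 : w₁ ≠ 0)
    (hlt : ∀ r, r ≠ 0 → w₁ < 2 * w r) (heq : ∀ r, r ≠ 0 → (w r = w₁ ↔ r.rank = 1))
    (Λ : Fin n → Matrix m (Fin k) F) :
    weightCount w w₁ (rightDual (generatorCode Λ) : Set (Fin n → Matrix (Fin k) (Fin k) F)) =
      ∑ j, (Finset.univ.filter fun r : Matrix (Fin k) (Fin k) F =>
        r.rank = 1 ∧ Λ j * r = 0).card := by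
  rw [← Finset.card_sigma, weightCount, ← Set.ncard_coe_finset]
  have hsum : ∀ j (r : Matrix (Fin k) (Fin k) F),
      ∑ i, Λ i * (Pi.single j r : Fin n → Matrix (Fin k) (Fin k) F) i = Λ j * r := by
    intro j r
    rw [Finset.sum_eq_single j, Pi.single_eq_same]
    · intro i _ hij
      rw [Pi.single_eq_of_ne hij, Matrix.mul_zero]
    · simp
  symm
  refine Set.ncard_congr (fun p _ => Pi.single p.1 p.2) ?_ ?_ ?_
  · rintro ⟨j, r⟩ h
    simp only [Finset.coe_sigma, Set.mem_sigma_iff, Finset.mem_coe, Finset.mem_filter,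
      Finset.mem_univ, true_and] at h
    refine ⟨?_, (vecWeight_eq_iff_exists_single hw0 hw1 hlt heq _).mpr ⟨j, r, h.1, rfl⟩⟩
    refine (mem_rightDual_generatorCode hk Λ _).mpr ?_
    rw [hsum, h.2]
  · rintro ⟨j, r⟩ ⟨j', r'⟩ h h' hjj
    simp only [Finset.coe_sigma, Set.mem_sigma_iff, Finset.mem_coe, Finset.mem_filter,
      Finset.mem_univ, true_and] at h h'
    have hr0 : r ≠ 0 := fun h0 => by
      rw [h0, rank_zero] at h
      exact zero_ne_one h.1
    have hj := congrFun hjj j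
    dsimp only at hj
    rw [Pi.single_eq_same] at hj
    by_cases hjj' : j = j'
    · subst hjj'
      rw [Pi.single_eq_same] at hj
      rw [hj]
    · rw [Pi.single_eq_of_ne hjj'] at hj
      exact absurd hj hr0
  · rintro y ⟨hy, hwy⟩
    obtain ⟨j, r, hr, rfl⟩ := (vecWeight_eq_iff_exists_single hw0 hw1 hlt heq y).mp hwy
    have := (mem_rightDual_generatorCode hk Λ _).mp hy
    rw [hsum] at this
    exact ⟨⟨j, r⟩, by simp [hr, this], rfl⟩

end DualCount

/-! ### Codes given by families of subspaces -/

section SubspaceFamilies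

variable {F : Type*} [Field F] {k n : ℕ} {m : Type*}

theorem exists_eq_vecMulVec_of_rank_eq_one {r : Matrix m (Fin k) F} (hr : r.rank = 1) :
    ∃ (v : m → F) (φ : Fin k → F), v ≠ 0 ∧ φ ≠ 0 ∧ r = vecMulVec v φ := by
  obtain ⟨⟨v, hv⟩, hv0, hspan⟩ := finrank_eq_one_iff'.mp hr
  choose φ hφ using fun j => hspan ⟨r *ᵥ Pi.single j 1, ⟨Pi.single j 1, rfl⟩⟩
  have hrv : r = vecMulVec v φ := by
    ext i j
    have := congrFun (congrArg Subtype.val (hφ j)) i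
    simp only [SetLike.mk_smul_mk, Pi.smul_apply, smul_eq_mul, mulVec_single_one] at this
    rw [vecMulVec_apply, mul_comm, this]
    rfl
  refine ⟨v, φ, fun h => hv0 (Subtype.ext h), fun h => ?_, hrv⟩
  rw [hrv, h] at hr
  have h0 : vecMulVec v (0 : Fin k → F) = 0 := by ext; simp [vecMulVec_apply]
  rw [h0, rank_zero] at hr
  exact zero_ne_one hr

variable [Fintype F] [Fintype m]

open Classical in
/-- A nonzero vector `v` is in the right kernel of `|U| ^ (k - 1)` of the matrices with columns in
`U`, so the same count holds for the matrices annihilating `v ⊗ φ`. -/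
theorem card_ofColumns_mul_eq_zero (U : Submodule F (m → F)) {r : Matrix (Fin k) (Fin k) F}
    (hr : r.rank = 1) :
    (Finset.univ.filter fun l : Fin k → U => ofColumns l * r = 0).card =
      Nat.card U ^ (k - 1) := by
  rw [Nat.card_eq_fintype_card]
  obtain ⟨v, φ, hv, hφ, rfl⟩ := exists_eq_vecMulVec_of_rank_eq_one hr
  set g : (Fin k → U) →ₗ[F] U := ∑ j, v j • LinearMap.proj j with hg
  have hgl : ∀ l, ((g l : U) : m → F) = ofColumns l *ᵥ v := by
    intro l
    ext i
    simp [hg, mulVec, dotProduct, ofColumns, mul_comm]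
  have hiff : ∀ l : Fin k → U, ofColumns l * vecMulVec v φ = 0 ↔ l ∈ LinearMap.ker g := by
    intro l
    rw [mul_vecMulVec, LinearMap.mem_ker, ← Submodule.coe_eq_zero, hgl]
    constructor
    · intro h
      obtain ⟨j, hj⟩ := Function.ne_iff.mp hφ
      ext i
      have := congrFun (congrFun h i) j
      rw [vecMulVec_apply] at this
      exact (mul_eq_zero.mp this).resolve_right hj
    · intro h
      rw [h]
      ext
      simp [vecMulVec_apply]
  obtain ⟨j, hj⟩ := Function.ne_iff.mp hv
  have hsurj : LinearMap.range g = ⊤ := by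
    rw [LinearMap.range_eq_top]
    intro u
    refine ⟨Pi.single j ((v j)⁻¹ • u), ?_⟩
    have : g (Pi.single j ((v j)⁻¹ • u)) = ∑ i, v i • (Pi.single j ((v j)⁻¹ • u) : Fin k → U) i := by
      simp [hg]
    rw [this, Finset.sum_eq_single j]
    · rw [Pi.single_eq_same, smul_smul, mul_inv_cancel₀ hj, one_smul]
    · intro i _ hij
      rw [Pi.single_eq_of_ne hij, smul_zero]
    · simp
  have hfin := LinearMap.finrank_range_add_finrank_ker g
  rw [hsurj, finrank_top, finrank_pi_fintype, Finset.sum_const, Finset.card_univ, Fintype.card_fin,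
    smul_eq_mul] at hfin
  have hker : finrank F (LinearMap.ker g) = finrank F U * (k - 1) := by
    rw [Nat.mul_sub_one, mul_comm]
    omega
  rw [Finset.filter_congr fun l _ => hiff l, ← Fintype.card_subtype]
  refine (Module.card_eq_pow_finrank (K := F) (V := LinearMap.ker g)).trans ?_
  rw [hker, pow_mul, ← Module.card_eq_pow_finrank]

open Classical in
theorem sum_card_ofColumns_mul_eq_zero {I : Type*} [Fintype I] (U : I → Submodule F (m → F))
    (e : Fin n ≃ Σ i, (Fin k → U i)) :
    ∑ j, (Finset.univ.filter fun r : Matrix (Fin k) (Fin k) F =>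
        r.rank = 1 ∧ ofColumns (e j).2 * r = 0).card =
      (Finset.univ.filter fun r : Matrix (Fin k) (Fin k) F => r.rank = 1).card *
        ∑ i, Nat.card (U i) ^ (k - 1) := by
  rw [e.sum_comp fun p => (Finset.univ.filter fun r : Matrix (Fin k) (Fin k) F =>
        r.rank = 1 ∧ ofColumns p.2 * r = 0).card, Fintype.sum_sigma, Finset.mul_sum]
  refine Finset.sum_congr rfl fun i _ => ?_
  simp_rw [← Finset.filter_filter]
  have := Finset.sum_card_bipartiteAbove_eq_sum_card_bipartiteBelow
    (s := (Finset.univ : Finset (Fin k → U i)))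
    (t := Finset.univ.filter fun r : Matrix (Fin k) (Fin k) F => r.rank = 1)
    (fun l r => ofColumns l * r = 0)
  refine this.trans ?_
  refine Finset.sum_const_nat fun r hr => ?_
  exact card_ofColumns_mul_eq_zero (U i) (Finset.mem_filter.mp hr).2

open Classical in
theorem vecWeight_mul_ofColumns {w : Matrix (Fin k) (Fin k) F → ℕ} {ζ : ℝ}
    (hval : ∀ r, (w r : ℝ) = ζ * (1 - rankCoeff (Fintype.card F) k r.rank))
    {I : Type*} [Fintype I] (U : I → Submodule F (m → F)) (e : Fin n ≃ Σ i, (Fin k → U i))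
    (x : Matrix (Fin k) m F) :
    (vecWeight w (fun j => x * ofColumns (e j).2) : ℝ) =
      ∑ i, if ∃ u ∈ U i, x *ᵥ u ≠ 0 then ζ * (Nat.card (U i) : ℝ) ^ k else 0 := by
  rw [vecWeight, Nat.cast_sum, e.sum_comp fun p => (w (x * ofColumns p.2) : ℝ), Fintype.sum_sigma]
  exact Finset.sum_congr rfl fun i _ => sum_weight_mul_ofColumns hval (U i) x

end SubspaceFamilies

/-! ### Hyperplanes, and a subspace of codimension two -/

section TwoFamilies

variable {F : Type*} [Field F] {k : ℕ}

/-- A choice of `q ^ k + 1` pairwise non-proportional linear forms on `F ^ (2 + k)`: the forms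
`(1, 0, v)` with `v ∈ F ^ k`, and the form `(0, 1, 0)`. -/
def pointForm : Option (Fin k → F) → Fin 2 ⊕ Fin k → F
  | some v => Sum.elim ![1, 0] v
  | none => Sum.elim ![0, 1] 0

theorem pointForm_ne_zero (i : Option (Fin k → F)) : pointForm i ≠ 0 := by
  rintro h
  cases i with
  | none => simpa [pointForm] using congrFun h (Sum.inl 1)
  | some v => simpa [pointForm] using congrFun h (Sum.inl 0)

theorem vecMulVec_pointForm_inj {i j : Option (Fin k → F)} {y z : Fin k → F} (hy : y ≠ 0)
    (h : vecMulVec y (pointForm i) = vecMulVec z (pointForm j)) : i = j ∧ y = z := by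
  have hent : ∀ a b, y a * pointForm i b = z a * pointForm j b := fun a b => by
    simpa [vecMulVec_apply] using congrFun (congrFun h a) b
  obtain ⟨a, ha⟩ := Function.ne_iff.mp hy
  have ha : y a ≠ 0 := ha
  cases i with
  | none =>
    cases j with
    | none => exact ⟨rfl, funext fun b => by simpa [pointForm] using hent b (Sum.inl 1)⟩
    | some v => exact absurd (by simpa [pointForm] using hent a (Sum.inl 1)) ha
  | some u =>
    cases j with
    | none => exact absurd (by simpa [pointForm] using hent a (Sum.inl 0)) ha
    | some v =>
      have hyz : y = z := funext fun b => by simpa [pointForm] using hent b (Sum.inl 0)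
      subst hyz
      refine ⟨congrArg some (funext fun b => ?_), rfl⟩
      exact mul_left_cancel₀ ha (by simpa [pointForm] using hent a (Sum.inr b))

/-- The hyperplanes cut out by the forms `pointForm i`. -/
def hyperplaneFamily (i : Option (Fin k → F)) : Submodule F (Fin 2 ⊕ Fin k → F) :=
  LinearMap.ker (dotProductBilin F F (pointForm i))

/-- The subspace of codimension two on which the first two coordinates vanish. -/
def codimTwo (F : Type*) [Field F] (k : ℕ) : Submodule F (Fin 2 ⊕ Fin k → F) :=
  LinearMap.ker (LinearMap.funLeft F F (Sum.inl : Fin 2 → Fin 2 ⊕ Fin k))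

/-- The whole space once, and `q ^ k` copies of a subspace of codimension two. -/
def flagFamily : Option (Fin k → F) → Submodule F (Fin 2 ⊕ Fin k → F)
  | some _ => codimTwo F k
  | none => ⊤

theorem exists_pointForm_dotProduct_eq_one (i : Option (Fin k → F)) :
    ∃ a, pointForm i ⬝ᵥ a = 1 := by
  obtain ⟨j, hj⟩ := Function.ne_iff.mp (pointForm_ne_zero i)
  exact ⟨Pi.single j (pointForm i j)⁻¹, by simpa using mul_inv_cancel₀ hj⟩

/-- A matrix annihilates the hyperplane of a linear form iff its rows are multiples of this form. -/
theorem forall_mem_hyperplaneFamily_iff (i : Option (Fin k → F))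
    (x : Matrix (Fin k) (Fin 2 ⊕ Fin k) F) :
    (∀ u ∈ hyperplaneFamily i, x *ᵥ u = 0) ↔ ∃ y, vecMulVec y (pointForm i) = x := by
  constructor
  · intro h
    obtain ⟨a, ha⟩ := exists_pointForm_dotProduct_eq_one i
    refine ⟨x *ᵥ a, ?_⟩
    ext b c
    have hmem : Pi.single c 1 - pointForm i c • a ∈ hyperplaneFamily i := by
      simp [hyperplaneFamily, dotProduct_sub, dotProduct_smul, ha]
    have := congrFun (h _ hmem) b
    rw [mulVec_sub, mulVec_smul, mulVec_single_one] at this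
    rw [vecMulVec_apply, mul_comm]
    exact (sub_eq_zero.mp this).symm
  · rintro ⟨y, rfl⟩ u hu
    have hu : pointForm i ⬝ᵥ u = 0 := hu
    rw [vecMulVec_mulVec, hu]
    simp

theorem forall_mem_codimTwo_iff (x : Matrix (Fin k) (Fin 2 ⊕ Fin k) F) :
    (∀ u ∈ codimTwo F k, x *ᵥ u = 0) ↔ ∃ y : Matrix (Fin k) (Fin 2) F, fromCols y 0 = x := by
  constructor
  · intro h
    refine ⟨x.toCols₁, ?_⟩
    have h2 : x.toCols₂ = 0 := by
      ext b c
      have hmem : Pi.single (Sum.inr c) 1 ∈ codimTwo F k := by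
        rw [codimTwo, LinearMap.mem_ker]
        ext j
        simp [LinearMap.funLeft]
      have := congrFun (h _ hmem) b
      rw [mulVec_single_one] at this
      exact this
    rw [← h2, fromCols_toCols]
  · rintro ⟨y, rfl⟩ u hu
    have hu : u ∘ Sum.inl = 0 := hu
    rw [fromCols_mulVec, hu, mulVec_zero, zero_mulVec, add_zero]

variable [Fintype F]

theorem card_hyperplaneFamily (i : Option (Fin k → F)) :
    Nat.card (hyperplaneFamily i) = Fintype.card F ^ (k + 1) := by
  have hne : (dotProductBilin F F (pointForm i) : Dual F (Fin 2 ⊕ Fin k → F)) ≠ 0 := by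
    intro h
    obtain ⟨a, ha⟩ := exists_pointForm_dotProduct_eq_one i
    have h0 : pointForm i ⬝ᵥ a = 0 := LinearMap.congr_fun h a
    exact one_ne_zero (ha.symm.trans h0)
  have h := Dual.finrank_ker_add_one_of_ne_zero hne
  rw [finrank_fintype_fun_eq_card, Fintype.card_sum, Fintype.card_fin, Fintype.card_fin] at h
  have h' : finrank F (LinearMap.ker (dotProductBilin F F (pointForm i))) = k + 1 := by
    refine Nat.add_right_cancel (h.trans ?_)
    omega
  rw [← Nat.card_eq_fintype_card]
  exact (Module.natCard_eq_pow_finrank (K := F)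
    (V := LinearMap.ker (dotProductBilin F F (pointForm i)))).trans (congrArg _ h')

theorem card_codimTwo :
    Nat.card (codimTwo F k) = Fintype.card F ^ k := by
  have h := LinearMap.finrank_range_add_finrank_ker
    (LinearMap.funLeft F F (Sum.inl : Fin 2 → Fin 2 ⊕ Fin k))
  rw [LinearMap.range_eq_top.mpr (LinearMap.funLeft_surjective_of_injective F F _
    Sum.inl_injective), finrank_top, finrank_fintype_fun_eq_card, finrank_fintype_fun_eq_card,
    Fintype.card_sum, Fintype.card_fin, Fintype.card_fin] at h
  rw [← Nat.card_eq_fintype_card]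
  exact (Module.natCard_eq_pow_finrank (K := F) (V := LinearMap.ker
    (LinearMap.funLeft F F (Sum.inl : Fin 2 → Fin 2 ⊕ Fin k)))).trans
    (congrArg _ (Nat.add_left_cancel h))

open Classical in
/-- The matrices `y ⊗ h` with `y ≠ 0` and `h` one of the forms `pointForm i`: the information words
of the smaller nonzero weight for `hyperplaneFamily`. -/
noncomputable def hyperplaneWords (F : Type*) [Field F] [Fintype F] (k : ℕ) :
    Finset (Matrix (Fin k) (Fin 2 ⊕ Fin k) F) :=
  (Finset.univ ×ˢ (Finset.univ.erase 0)).image fun p : Option (Fin k → F) × (Fin k → F) =>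
    vecMulVec p.2 (pointForm p.1)

open Classical in
/-- The nonzero matrices supported on the first two columns: the information words of the smaller
nonzero weight for `flagFamily`. -/
noncomputable def flagWords (F : Type*) [Field F] [Fintype F] (k : ℕ) :
    Finset (Matrix (Fin k) (Fin 2 ⊕ Fin k) F) :=
  (Finset.univ.erase 0).image fun y : Matrix (Fin k) (Fin 2) F => fromCols y 0

theorem mem_hyperplaneWords {x : Matrix (Fin k) (Fin 2 ⊕ Fin k) F} :
    x ∈ hyperplaneWords F k ↔ ∃ i, ∃ y ≠ 0, vecMulVec y (pointForm i) = x := by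
  simp [hyperplaneWords]

theorem mem_flagWords {x : Matrix (Fin k) (Fin 2 ⊕ Fin k) F} :
    x ∈ flagWords F k ↔ ∃ y : Matrix (Fin k) (Fin 2) F, y ≠ 0 ∧ fromCols y 0 = x := by
  simp [flagWords]

theorem zero_notMem_hyperplaneWords : 0 ∉ hyperplaneWords F k := by
  rw [mem_hyperplaneWords]
  rintro ⟨i, y, hy, h⟩
  refine hy (vecMulVec_pointForm_inj (i := i) (j := i) (z := 0) hy ?_).2
  rw [h]
  ext; simp [vecMulVec_apply]

theorem zero_notMem_flagWords : 0 ∉ flagWords F k := by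
  rw [mem_flagWords]
  rintro ⟨y, hy, h⟩
  refine hy ?_
  ext a b
  exact congrFun (congrFun h a) (Sum.inl b)

/-- The coincidence `(q ^ k + 1) (q ^ k - 1) = q ^ (2 k) - 1`. -/
theorem card_hyperplaneWords : (hyperplaneWords F k).card = (flagWords F k).card := by
  classical
  rw [hyperplaneWords, flagWords, Finset.card_image_of_injOn, Finset.card_image_of_injOn,
    Finset.card_product, Finset.card_erase_of_mem (Finset.mem_univ _),
    Finset.card_erase_of_mem (Finset.mem_univ _), Finset.card_univ, Finset.card_univ,
    Finset.card_univ, Fintype.card_option, Fintype.card_fun, Fintype.card_fin]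
  · have : Fintype.card (Matrix (Fin k) (Fin 2) F) = (Fintype.card F ^ k) ^ 2 := by
      rw [Fintype.card_congr (Matrix.of (m := Fin k) (n := Fin 2) (α := F)).symm, Fintype.card_fun,
        Fintype.card_fun, Fintype.card_fin, Fintype.card_fin, pow_right_comm]
    rw [this, ← one_pow 2, Nat.sq_sub_sq, one_pow]
  · intro y _ z _ h
    ext a b
    exact congrFun (congrFun h a) (Sum.inl b)
  · rintro ⟨i, y⟩ hy ⟨j, z⟩ _ h
    have hy0 : y ≠ 0 := by simpa using hy
    obtain ⟨rfl, rfl⟩ := vecMulVec_pointForm_inj hy0 h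
    rfl

open Classical in
theorem sum_ite_hyperplaneFamily (c : ℝ) {x : Matrix (Fin k) (Fin 2 ⊕ Fin k) F} (hx : x ≠ 0) :
    (∑ i, if ∃ u ∈ hyperplaneFamily i, x *ᵥ u ≠ 0 then c else 0) =
      if x ∈ hyperplaneWords F k then c * (Fintype.card F : ℝ) ^ k
        else c * ((Fintype.card F : ℝ) ^ k + 1) := by
  have hiff : ∀ i, (∃ u ∈ hyperplaneFamily i, x *ᵥ u ≠ 0) ↔
      ¬∃ y, vecMulVec y (pointForm i) = x := by
    intro i
    rw [← forall_mem_hyperplaneFamily_iff]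
    push Not
    rfl
  have hcard : (Fintype.card (Option (Fin k → F)) : ℝ) = (Fintype.card F : ℝ) ^ k + 1 := by
    simp
  simp_rw [hiff, ite_not]
  split_ifs with h
  · obtain ⟨i, y, hy, rfl⟩ := mem_hyperplaneWords.mp h
    have huniq : ∀ j, (∃ z, vecMulVec z (pointForm j) = vecMulVec y (pointForm i)) ↔ j = i :=
      fun j => ⟨fun ⟨z, hz⟩ => (vecMulVec_pointForm_inj hy hz.symm).1.symm, fun h => ⟨y, by rw [h]⟩⟩
    simp_rw [huniq]
    have hsplit : ∀ j, (if j = i then (0 : ℝ) else c) = c - if j = i then c else 0 := by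
      intro j
      split_ifs <;> simp
    simp_rw [hsplit]
    rw [Finset.sum_sub_distrib, Finset.sum_ite_eq' Finset.univ i, if_pos (Finset.mem_univ _),
      Finset.sum_const, nsmul_eq_mul, Finset.card_univ, hcard]
    ring
  · have hno : ∀ j, ¬∃ z, vecMulVec z (pointForm j) = x := by
      rintro j ⟨z, rfl⟩
      refine h (mem_hyperplaneWords.mpr ⟨j, z, ?_, rfl⟩)
      rintro rfl
      refine hx ?_
      ext; simp [vecMulVec_apply]
    simp_rw [hno, if_false]
    rw [Finset.sum_const, nsmul_eq_mul, Finset.card_univ, hcard, mul_comm]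

open Classical in
theorem sum_ite_flagFamily (c d : ℝ) {x : Matrix (Fin k) (Fin 2 ⊕ Fin k) F} (hx : x ≠ 0)
    (f : Option (Fin k → F) → ℝ) (hf : f none = c) (hf' : ∀ v, f (some v) = d) :
    (∑ i, if ∃ u ∈ flagFamily i, x *ᵥ u ≠ 0 then f i else 0) =
      if x ∈ flagWords F k then c else c + (Fintype.card F : ℝ) ^ k * d := by
  have hnone : ∃ u ∈ flagFamily (none : Option (Fin k → F)), x *ᵥ u ≠ 0 := by
    by_contra! h
    refine hx ?_
    ext a b
    have := congrFun (h (Pi.single b 1) trivial) a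
    rw [mulVec_single_one] at this
    exact this
  have hsome : ∀ v, (∃ u ∈ flagFamily (some v : Option (Fin k → F)), x *ᵥ u ≠ 0) ↔
      x ∉ flagWords F k := by
    intro v
    rw [← not_iff_not, not_not, mem_flagWords]
    push Not
    refine (forall_mem_codimTwo_iff x).trans ⟨?_, fun ⟨y, _, h⟩ => ⟨y, h⟩⟩
    rintro ⟨y, rfl⟩
    refine ⟨y, ?_, rfl⟩
    rintro rfl
    exact hx (by ext a (b | b) <;> rfl)
  rw [Fintype.sum_option, if_pos hnone, hf]
  simp_rw [hsome, hf', ite_not]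
  split_ifs
  · simp
  · simp

end TwoFamilies

/-! ### Codes with equal weight enumerators and different duals -/

section ExistsCodes

variable {F : Type*} [Field F] [Fintype F] {k : ℕ} {w : Matrix (Fin k) (Fin k) F → ℕ}

/-- The codes given by `hyperplaneFamily` and by `flagFamily` have the same length and the same
weight enumerator, but their duals contain different numbers of vectors with a single nonzero entry
of rank one. -/
theorem IsHomogeneousWeight.exists_weightEnumerator_eq_and_weightCount_ne (hk : 2 ≤ k)
    (h22 : ¬(k = 2 ∧ Fintype.card F = 2)) (hw : IsHomogeneousWeight fun r => (w r : ℝ)) :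
    ∃ n : ℕ, 1 ≤ n ∧
      ∃ C D : Submodule (Matrix (Fin k) (Fin k) F) (Fin n → Matrix (Fin k) (Fin k) F),
        weightEnumerator w (C : Set (Fin n → Matrix (Fin k) (Fin k) F)) =
          weightEnumerator w (D : Set (Fin n → Matrix (Fin k) (Fin k) F)) ∧
        ∀ r₁ : Matrix (Fin k) (Fin k) F, r₁.rank = 1 →
          weightCount w (w r₁) (rightDual C : Set (Fin n → Matrix (Fin k) (Fin k) F)) ≠
            weightCount w (w r₁) (rightDual D : Set (Fin n → Matrix (Fin k) (Fin k) F)) := by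
  classical
  have hw0 : w 0 = 0 := Nat.cast_eq_zero.mp hw.1
  obtain ⟨ζ, hζ, hval⟩ := hw.exists_eq_rankCoeff
  set q := Fintype.card F with hq
  have hq1 : 1 < q := Fintype.one_lt_card
  have hcardC : ∀ i, Nat.card (hyperplaneFamily (F := F) (k := k) i) = q ^ (k + 1) :=
    card_hyperplaneFamily
  have hcardD0 : Nat.card (flagFamily (none : Option (Fin k → F))) = q ^ (k + 2) := by
    change Nat.card (⊤ : Submodule F (Fin 2 ⊕ Fin k → F)) = _
    rw [Module.natCard_eq_pow_finrank (K := F), finrank_top, finrank_fintype_fun_eq_card,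
      Fintype.card_sum, Fintype.card_fin, Fintype.card_fin, add_comm, Nat.card_eq_fintype_card]
  have hcardD1 : ∀ v, Nat.card (flagFamily (some v : Option (Fin k → F))) = q ^ k := fun v =>
    card_codimTwo (F := F) (k := k)
  have hpoints : Fintype.card (Fin k → F) = q ^ k := by simp [hq]
  have hlen : Nat.card (Σ i, (Fin k → hyperplaneFamily (F := F) (k := k) i)) =
      Nat.card (Σ i, (Fin k → flagFamily (F := F) (k := k) i)) := by
    simp only [Nat.card_sigma, Nat.card_fun, Nat.card_eq_fintype_card (α := Fin k),
      Fintype.card_fin, Fintype.sum_option, hcardC, hcardD0, hcardD1, Finset.sum_const,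
      Finset.card_univ, smul_eq_mul, Fintype.card_option, hpoints]
    ring
  set n := Nat.card (Σ i, (Fin k → hyperplaneFamily (F := F) (k := k) i)) with hn
  have eC : Fin n ≃ Σ i, (Fin k → hyperplaneFamily (F := F) (k := k) i) :=
    (Finite.equivFinOfCardEq hn.symm).symm
  have eD : Fin n ≃ Σ i, (Fin k → flagFamily (F := F) (k := k) i) :=
    (Finite.equivFinOfCardEq hlen.symm).symm
  refine ⟨n, Nat.card_pos_iff.mpr ⟨⟨⟨none, 0⟩⟩, inferInstance⟩,
    generatorCode fun j => ofColumns (eC j).2, generatorCode fun j => ofColumns (eD j).2, ?_, ?_⟩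
  · have hqR : (0 : ℝ) < q := by exact_mod_cast (zero_lt_one.trans hq1)
    refine weightEnumerator_generatorCode_eq w hw0 _ _
      (α := ζ * ((q : ℝ) ^ (k + 1)) ^ k * (q : ℝ) ^ k)
      (β := ζ * ((q : ℝ) ^ (k + 1)) ^ k * ((q : ℝ) ^ k + 1))
      (by positivity) (by positivity) (hyperplaneWords F k) (flagWords F k)
      zero_notMem_hyperplaneWords zero_notMem_flagWords card_hyperplaneWords ?_ ?_
    · intro x
      rw [vecWeight_mul_ofColumns hval]
      split_ifs with hx hxB
      · simp [hx]
      · simp_rw [hcardC, Nat.cast_pow]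
        rw [sum_ite_hyperplaneFamily _ hx, if_pos hxB]
      · simp_rw [hcardC, Nat.cast_pow]
        rw [sum_ite_hyperplaneFamily _ hx, if_neg hxB]
    · intro x
      rw [vecWeight_mul_ofColumns hval]
      by_cases hx : x = 0
      · simp [hx]
      have hsum := sum_ite_flagFamily (ζ * ((q : ℝ) ^ (k + 2)) ^ k) (ζ * ((q : ℝ) ^ k) ^ k) hx
        (fun i => ζ * (Nat.card (flagFamily i) : ℝ) ^ k) (by rw [hcardD0, Nat.cast_pow])
        (fun v => by rw [hcardD1, Nat.cast_pow])
      rw [if_neg hx]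
      refine (Eq.trans (by congr!) hsum).trans ?_
      split_ifs
      · ring
      · rw [← hq]
        ring
  · intro r₁ hr₁
    have hr₁0 : r₁ ≠ 0 := fun h => by
      rw [h, rank_zero] at hr₁
      exact zero_ne_one hr₁
    have hw1 : w r₁ ≠ 0 := by
      have := (hw.lt_two_mul_and_eq_iff hk h22 hr₁ hr₁0).1
      omega
    have hcount : ∀ Λ : Fin n → Matrix (Fin 2 ⊕ Fin k) (Fin k) F, _ := fun Λ =>
      weightCount_rightDual_generatorCode (by omega) hw0 hw1
        (fun r hr => (hw.lt_two_mul_and_eq_iff hk h22 hr₁ hr).1)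
        (fun r hr => (hw.lt_two_mul_and_eq_iff hk h22 hr₁ hr).2.1) Λ
    rw [hcount, hcount, sum_card_ofColumns_mul_eq_zero, sum_card_ofColumns_mul_eq_zero]
    intro h
    have hpos : 0 < (Finset.univ.filter fun r : Matrix (Fin k) (Fin k) F => r.rank = 1).card :=
      Finset.card_pos.mpr ⟨r₁, Finset.mem_filter.mpr ⟨Finset.mem_univ _, hr₁⟩⟩
    have h' := Nat.eq_of_mul_eq_mul_left hpos h
    simp only [Fintype.sum_option, hcardC, hcardD0, hcardD1, Finset.sum_const, Finset.card_univ,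
      smul_eq_mul, Fintype.card_option, hpoints] at h'
    obtain ⟨j, rfl⟩ : ∃ j, k = j + 1 := ⟨k - 1, by omega⟩
    rw [Nat.add_sub_cancel] at h'
    have hQ : 1 < q ^ j := Nat.one_lt_pow (by omega) hq1
    have hB : 0 < (q ^ (j + 1)) ^ j := by positivity
    -- With `Q = q ^ (k - 1)`, the two counts differ by the factor `(q - 1) (Q - 1)`.
    have h1 : (q ^ (j + 1)) ^ j * q ^ j * (q * q ^ j + 1) =
        (q ^ (j + 1)) ^ j * q ^ j * (q ^ j + q) := by
      have e1 : (q ^ (j + 1 + 1)) ^ j = (q ^ (j + 1)) ^ j * q ^ j := by ring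
      have e2 : (q ^ (j + 1 + 2)) ^ j = (q ^ (j + 1)) ^ j * q ^ j * q ^ j := by ring
      rw [e1, e2] at h'
      rw [pow_succ q j] at h' ⊢
      linarith
    have h2 := Nat.eq_of_mul_eq_mul_left (by positivity) h1
    nlinarith

end ExistsCodes

/-! ### The Bachoc weight on two by two matrices over the field with two elements -/

section BachocWeight

/-- The nontrivial additive character of the field with two elements, with values in `ℤ`. -/
def signChar {F : Type*} [Zero F] [DecidableEq F] (t : F) : ℤ := if t = 0 then 1 else -1

/-- The Bachoc weight on `M₂(𝔽₂)`: `0` at zero, `1` at units and `2` at the nonzero singular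
matrices. It is the Hamming weight under an additive isomorphism `M₂(𝔽₂) ≃ 𝔽₄ × 𝔽₄`. -/
def bachocWeight {F : Type*} [CommRing F] [DecidableEq F] (r : Matrix (Fin 2) (Fin 2) F) : ℕ :=
  if r = 0 then 0 else if r.det = 0 then 2 else 1

theorem bachocWeight_le_two {F : Type*} [CommRing F] [DecidableEq F]
    (r : Matrix (Fin 2) (Fin 2) F) : bachocWeight r ≤ 2 := by
  unfold bachocWeight
  split_ifs <;> omega

/-- The Fourier transforms of the indicator functions of the three weight classes of `M₂(𝔽₂)`; the
row of the table for the weight `i` holds the coefficients of `(a + 3 b) ^ (2 - i) (a - b) ^ i`. -/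
theorem sum_signChar_zmod_two : ∀ x : Matrix (Fin 2) (Fin 2) (ZMod 2), ∀ j : Fin 3,
    ∑ y : Matrix (Fin 2) (Fin 2) (ZMod 2) with bachocWeight y = j, signChar (x * y).trace =
      (![![1, 6, 9], ![1, 2, -3], ![1, -2, 1]] : Fin 3 → Fin 3 → ℤ)
        (Fin.ofNat 3 (bachocWeight x)) j := by
  decide +kernel


variable {F : Type*} [Field F] [DecidableEq F]

theorem prod_pow_bachocWeight {n : ℕ} {A : Type*} [CommRing A] (a b : A)
    (x : Fin n → Matrix (Fin 2) (Fin 2) F) :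
    ∏ i, a ^ (2 - bachocWeight (x i)) * b ^ bachocWeight (x i) =
      a ^ (n * 2 - vecWeight bachocWeight x) * b ^ vecWeight bachocWeight x := by
  rw [Finset.prod_mul_distrib, Finset.prod_pow_eq_pow_sum, Finset.prod_pow_eq_pow_sum,
    Finset.sum_tsub_distrib _ fun i _ => bachocWeight_le_two (x i)]
  simp [vecWeight]

theorem bachocWeight_eq_of_rank (r : Matrix (Fin 2) (Fin 2) F) :
    bachocWeight r = if r.rank = 0 then 0 else if r.rank = 1 then 2 else 1 := by
  have h2 : r.rank = 2 ↔ r.det ≠ 0 := by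
    constructor
    · intro h hdet
      obtain ⟨v, hv, hrv⟩ := Matrix.exists_mulVec_eq_zero_iff.mpr hdet
      have hfin := LinearMap.finrank_range_add_finrank_ker r.mulVecLin
      rw [finrank_fin_fun] at hfin
      change r.rank + _ = 2 at hfin
      have hker : LinearMap.ker r.mulVecLin = ⊥ := Submodule.finrank_eq_zero.mp (by omega)
      exact hv ((Submodule.mem_bot F).mp (hker ▸ (LinearMap.mem_ker.mpr hrv)))
    · intro h
      simpa using rank_of_isUnit r ((isUnit_iff_isUnit_det r).mpr h.isUnit)
  have hle : r.rank ≤ 2 := rank_le_width r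
  unfold bachocWeight
  by_cases h0 : r = 0
  · rw [if_pos h0, if_pos (rank_eq_zero_iff_eq_zero.mpr h0)]
  · have h0' : r.rank ≠ 0 := fun h => h0 (rank_eq_zero_iff_eq_zero.mp h)
    rw [if_neg h0, if_neg h0']
    by_cases hd : r.det = 0
    · rw [if_pos hd, if_pos]
      have : r.rank ≠ 2 := fun h => h2.mp h hd
      omega
    · rw [if_neg hd, if_neg]
      have := h2.mpr hd
      omega

variable [Fintype F]

/-- The local MacWilliams identity: the finite Fourier transform of the symmetrised weight
`a ^ (2 - w) b ^ w` on `M₂(𝔽₂)` has the form it has for the Hamming weight on `𝔽₄ ^ 2`. -/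
theorem sum_signChar_mul_pow_bachocWeight (hF : Fintype.card F = 2) {A : Type*} [CommRing A]
    (a b : A) (x : Matrix (Fin 2) (Fin 2) F) :
    ∑ y : Matrix (Fin 2) (Fin 2) F,
        (signChar (x * y).trace : A) * (a ^ (2 - bachocWeight y) * b ^ bachocWeight y) =
      (a + 3 * b) ^ (2 - bachocWeight x) * (a - b) ^ bachocWeight x := by
  let e : F ≃+* ZMod 2 := (ZMod.ringEquivOfPrime F Nat.prime_two hF).symm
  let E : Matrix (Fin 2) (Fin 2) F ≃+* Matrix (Fin 2) (Fin 2) (ZMod 2) := e.mapMatrix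
  have hw : ∀ y, bachocWeight (E y) = bachocWeight y := by
    intro y
    have hdet : (E y).det = e y.det := (RingEquiv.map_det e y).symm
    simp only [bachocWeight, hdet, map_eq_zero_iff E E.injective, map_eq_zero_iff e e.injective]
  have hs : ∀ y, signChar (E x * E y).trace = signChar (x * y).trace := by
    intro y
    have htr : (E (x * y)).trace = e (x * y).trace :=
      (AddMonoidHom.map_trace e.toAddMonoidHom _).symm
    rw [← map_mul, htr]
    simp only [signChar, map_eq_zero_iff e e.injective]
  rw [← hw x]
  have htrans : ∀ y,
      (signChar (x * y).trace : A) * (a ^ (2 - bachocWeight y) * b ^ bachocWeight y) =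
      (fun z => (signChar (E x * z).trace : A) * (a ^ (2 - bachocWeight z) * b ^ bachocWeight z))
        (E y) := by
    intro y
    simp only [hw, hs]
  rw [Finset.sum_congr rfl fun y _ => htrans y]
  refine (Equiv.sum_comp E.toEquiv fun z =>
    (signChar (E x * z).trace : A) * (a ^ (2 - bachocWeight z) * b ^ bachocWeight z)).trans ?_
  generalize E x = x
  have hfib : ∀ y : Matrix (Fin 2) (Fin 2) (ZMod 2), bachocWeight y < 3 := fun y =>
    Nat.lt_succ_of_le (bachocWeight_le_two y)
  have hj : ∀ j : Fin 3,
      (∑ y : Matrix (Fin 2) (Fin 2) (ZMod 2) with bachocWeight y = j,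
        (signChar (x * y).trace : A) * (a ^ (2 - bachocWeight y) * b ^ bachocWeight y)) =
      (((![![1, 6, 9], ![1, 2, -3], ![1, -2, 1]] : Fin 3 → Fin 3 → ℤ)
        (Fin.ofNat 3 (bachocWeight x)) j : ℤ) : A) * (a ^ (2 - (j : ℕ)) * b ^ (j : ℕ)) := by
    intro j
    rw [← sum_signChar_zmod_two, Int.cast_sum, Finset.sum_mul]
    exact Finset.sum_congr rfl fun y hy => by rw [(Finset.mem_filter.mp hy).2]
  rw [← Finset.sum_fiberwise_of_maps_to (t := Finset.range 3) (g := bachocWeight)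
    fun y _ => Finset.mem_range.mpr (hfib y), ← Fin.sum_univ_eq_sum_range (fun j =>
      ∑ y : Matrix (Fin 2) (Fin 2) (ZMod 2) with bachocWeight y = j,
        (signChar (x * y).trace : A) * (a ^ (2 - bachocWeight y) * b ^ bachocWeight y)),
    Fin.sum_univ_three, hj, hj, hj]
  have hx := hfib x
  interval_cases bachocWeight x <;> simp [Fin.ofNat] <;> ring

theorem signChar_add (hF : Fintype.card F = 2) (s t : F) :
    signChar (s + t) = signChar s * signChar t := by
  let e : F ≃+* ZMod 2 := (ZMod.ringEquivOfPrime F Nat.prime_two hF).symm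
  have he : ∀ s, signChar (e s) = signChar s := fun s => by
    simp only [signChar, map_eq_zero_iff e e.injective]
  have h2 : ∀ s t : ZMod 2, signChar (s + t) = signChar s * signChar t := by decide
  rw [← he, map_add, h2, he, he]

theorem signChar_sum (hF : Fintype.card F = 2) {ι : Type*} (s : Finset ι) (t : ι → F) :
    signChar (∑ i ∈ s, t i) = ∏ i ∈ s, signChar (t i) := by
  classical
  induction s using Finset.induction_on with
  | empty => simp [signChar]
  | insert i s hi ih => rw [Finset.sum_insert hi, Finset.prod_insert hi, signChar_add hF, ih]

variable {n : ℕ}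

open Classical in
/-- Orthogonality of characters: the words of the dual code are those on which all characters of the
code are trivial. The trace form suffices because the code is a left submodule. -/
theorem sum_signChar_code (hF : Fintype.card F = 2)
    (C : Submodule (Matrix (Fin 2) (Fin 2) F) (Fin n → Matrix (Fin 2) (Fin 2) F))
    (y : Fin n → Matrix (Fin 2) (Fin 2) F) :
    ∑ x : Fin n → Matrix (Fin 2) (Fin 2) F with x ∈ (C : Set _),
        signChar (∑ i, x i * y i).trace =
      if y ∈ rightDual C then
        ((Finset.univ.filter fun x => x ∈ (C : Set (Fin n → Matrix (Fin 2) (Fin 2) F))).card : ℤ)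
      else 0 := by
  split_ifs with hy
  · rw [Finset.cast_card]
    refine Finset.sum_congr rfl fun x hx => ?_
    rw [hy x (Finset.mem_filter.mp hx).2, trace_zero, signChar, if_pos rfl]
  · obtain ⟨x, hx, hxy⟩ : ∃ x ∈ C, ∑ i, x i * y i ≠ 0 := by
      by_contra! h
      exact hy h
    obtain ⟨i, hi⟩ := Function.ne_iff.mp hxy
    obtain ⟨j, hj⟩ := Function.ne_iff.mp hi
    set z : Fin n → Matrix (Fin 2) (Fin 2) F := Matrix.single j i (1 : F) • x with hz
    have hzC : z ∈ C := C.smul_mem _ hx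
    have htr : (∑ i, z i * y i).trace ≠ 0 := by
      have h1 : ∑ i, z i * y i = Matrix.single j i (1 : F) * ∑ i, x i * y i := by
        rw [Finset.mul_sum]
        exact Finset.sum_congr rfl fun i _ => by rw [hz, Pi.smul_apply, smul_eq_mul, mul_assoc]
      rw [h1, trace_single_mul]
      simpa using hj
    have hsign : ∀ x : Fin n → Matrix (Fin 2) (Fin 2) F,
        signChar (∑ i, (x + z) i * y i).trace = -signChar (∑ i, x i * y i).trace := by
      intro x
      simp only [Pi.add_apply, add_mul, Finset.sum_add_distrib, trace_add]
      rw [signChar_add hF, signChar.eq_def (Matrix.trace (∑ i, z i * y i)), if_neg htr]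
      ring
    have hshift : ∑ x : Fin n → Matrix (Fin 2) (Fin 2) F with x ∈ (C : Set _),
        signChar (∑ i, x i * y i).trace =
        ∑ x : Fin n → Matrix (Fin 2) (Fin 2) F with x ∈ (C : Set _),
          signChar (∑ i, (x + z) i * y i).trace := by
      refine (Finset.sum_equiv (Equiv.addRight z) (fun x => ?_) fun x _ => rfl).symm
      rw [Finset.mem_filter, Finset.mem_filter]
      simp only [Finset.mem_univ, true_and, SetLike.mem_coe, Equiv.coe_addRight]
      exact (C.add_mem_iff_left hzC).symm
    have hneg := hshift
    simp only [hsign, Finset.sum_neg_distrib] at hneg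
    omega

open Classical in
/-- The MacWilliams identity for the Bachoc weight. -/
theorem card_mul_sum_rightDual (hF : Fintype.card F = 2) {A : Type*} [CommRing A] (a b : A)
    (C : Submodule (Matrix (Fin 2) (Fin 2) F) (Fin n → Matrix (Fin 2) (Fin 2) F)) :
    ((Finset.univ.filter fun x => x ∈ (C : Set (Fin n → Matrix (Fin 2) (Fin 2) F))).card : A) *
        ∑ y : Fin n → Matrix (Fin 2) (Fin 2) F with y ∈ (rightDual C : Set _),
          a ^ (n * 2 - vecWeight bachocWeight y) * b ^ vecWeight bachocWeight y =
      ∑ x : Fin n → Matrix (Fin 2) (Fin 2) F with x ∈ (C : Set _),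
        (a + 3 * b) ^ (n * 2 - vecWeight bachocWeight x) * (a - b) ^ vecWeight bachocWeight x := by
  set g : (Fin n → Matrix (Fin 2) (Fin 2) F) → A := fun y =>
    a ^ (n * 2 - vecWeight bachocWeight y) * b ^ vecWeight bachocWeight y with hg
  have hfourier : ∀ x : Fin n → Matrix (Fin 2) (Fin 2) F,
      (a + 3 * b) ^ (n * 2 - vecWeight bachocWeight x) * (a - b) ^ vecWeight bachocWeight x =
        ∑ y, (signChar (∑ i, x i * y i).trace : A) * g y := by
    intro x
    rw [← prod_pow_bachocWeight,
      Finset.prod_congr rfl fun i _ => (sum_signChar_mul_pow_bachocWeight hF a b (x i)).symm,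
      Finset.prod_univ_sum, Fintype.piFinset_univ]
    refine Finset.sum_congr rfl fun y _ => ?_
    rw [Finset.prod_mul_distrib, prod_pow_bachocWeight, trace_sum, signChar_sum hF, Int.cast_prod]
  rw [Finset.sum_congr rfl fun x _ => hfourier x, Finset.sum_comm, Finset.mul_sum,
    Finset.sum_filter]
  refine Finset.sum_congr rfl fun y _ => ?_
  rw [← Finset.sum_mul, ← Int.cast_sum, sum_signChar_code hF C y]
  by_cases hy : y ∈ rightDual C
  · rw [if_pos hy, if_pos (by exact hy), Int.cast_natCast]
  · rw [if_neg hy, if_neg (by exact hy), Int.cast_zero, zero_mul]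

/-- On `M₂(𝔽₂)` every integer-valued homogeneous weight is a multiple of the Bachoc weight. -/
theorem IsHomogeneousWeight.exists_eq_mul_bachocWeight (hF : Fintype.card F = 2)
    {w : Matrix (Fin 2) (Fin 2) F → ℕ} (hw : IsHomogeneousWeight fun r => (w r : ℝ)) :
    ∃ s : ℕ, 0 < s ∧ ∀ r, w r = s * bachocWeight r := by
  obtain ⟨ζ, hζ, hval⟩ := hw.exists_eq_rankCoeff
  rw [hF] at hval
  have hc : ∀ r : Matrix (Fin 2) (Fin 2) F, (w r : ℝ) = (2 / 3 * ζ) * bachocWeight r := by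
    intro r
    rw [hval, bachocWeight_eq_of_rank]
    have hle : r.rank ≤ 2 := rank_le_width r
    interval_cases r.rank
    · simp [rankCoeff]
    · rw [rankCoeff_one]
      norm_num
      ring
    · rw [rankCoeff_two]
      norm_num
      ring
  have h1 : bachocWeight (1 : Matrix (Fin 2) (Fin 2) F) = 1 := by simp [bachocWeight]
  have hs := hc 1
  rw [h1, Nat.cast_one, mul_one] at hs
  refine ⟨w 1, ?_, fun r => ?_⟩
  · have : (0 : ℝ) < w 1 := by rw [hs]; positivity
    exact_mod_cast this
  · have := hc r
    rw [← hs] at this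
    exact_mod_cast this

theorem IsHomogeneousWeight.respectsDuality (hF : Fintype.card F = 2)
    {w : Matrix (Fin 2) (Fin 2) F → ℕ} (hw : IsHomogeneousWeight fun r => (w r : ℝ)) :
    RespectsDuality w := by
  classical
  obtain ⟨s, hs, hval⟩ := hw.exists_eq_mul_bachocWeight hF
  have hvec : ∀ {n : ℕ} (x : Fin n → Matrix (Fin 2) (Fin 2) F),
      vecWeight w x = s * vecWeight bachocWeight x := fun x => by
    simp [vecWeight, hval, Finset.mul_sum]
  have hmax : maxWeight w = s * 2 := by
    refine le_antisymm (Finset.sup_le fun r _ => ?_) ?_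
    · rw [hval]
      exact Nat.mul_le_mul_left s (bachocWeight_le_two r)
    · have h := Finset.le_sup (f := w) (Finset.mem_univ (Matrix.single 0 0 (1 : F)))
      have h2 : bachocWeight (Matrix.single 0 0 (1 : F) : Matrix (Fin 2) (Fin 2) F) = 2 := by
        have hne : (Matrix.single 0 0 (1 : F) : Matrix (Fin 2) (Fin 2) F) ≠ 0 := fun h =>
          one_ne_zero (α := F) (by simpa using congrFun (congrFun h 0) 0)
        simp [bachocWeight, det_fin_two, hne]
      rwa [hval, h2] at h
  intro n _ C D hCD
  set a : MvPolynomial (Fin 2) ℤ := MvPolynomial.X 0 ^ s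
  set b : MvPolynomial (Fin 2) ℤ := MvPolynomial.X 1 ^ s
  have hdual : ∀ C : Submodule (Matrix (Fin 2) (Fin 2) F) (Fin n → Matrix (Fin 2) (Fin 2) F),
      ((Finset.univ.filter fun x => x ∈ (C : Set (Fin n → Matrix (Fin 2) (Fin 2) F))).card :
          MvPolynomial (Fin 2) ℤ) *
        weightEnumerator w (rightDual C : Set (Fin n → Matrix (Fin 2) (Fin 2) F)) =
      ∑ x : Fin n → Matrix (Fin 2) (Fin 2) F with x ∈ (C : Set _),
        (fun t : ℕ => (a + 3 * b) ^ (n * 2 - t / s) * (a - b) ^ (t / s)) (vecWeight w x) := by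
    intro C
    have h := card_mul_sum_rightDual hF a b C
    convert h using 2
    · rw [weightEnumerator]
      refine Finset.sum_congr rfl fun y _ => ?_
      rw [hmax, hvec, ← pow_mul, ← pow_mul, Nat.mul_sub, mul_left_comm]
    · simp only [hvec, Nat.mul_div_cancel_left _ hs]
  have hcard : (Finset.univ.filter fun x => x ∈ (C : Set (Fin n → Matrix (Fin 2) (Fin 2) F))).card =
      (Finset.univ.filter fun x => x ∈ (D : Set (Fin n → Matrix (Fin 2) (Fin 2) F))).card := by
    simpa using sum_comp_vecWeight_eq_of_weightEnumerator_eq hCD fun _ => (1 : ℕ)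
  have hpos :
      ((Finset.univ.filter fun x => x ∈ (D : Set (Fin n → Matrix (Fin 2) (Fin 2) F))).card :
        MvPolynomial (Fin 2) ℤ) ≠ 0 :=
    Nat.cast_ne_zero.mpr (Finset.card_ne_zero_of_mem
      (Finset.mem_filter.mpr ⟨Finset.mem_univ 0, D.zero_mem⟩))
  refine mul_left_cancel₀ hpos ?_
  rw [hdual D, ← hcard, hdual C]
  exact sum_comp_vecWeight_eq_of_weightEnumerator_eq hCD fun t =>
    (a + 3 * b) ^ (n * 2 - t / s) * (a - b) ^ (t / s)

end BachocWeight

/-! ### Duality and homogeneous weights -/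

theorem mainTheorem1 (F : Type*) [Field F] [Fintype F] (k : ℕ) (hk : 2 ≤ k)
    (w : Matrix (Fin k) (Fin k) F → ℕ)
    (hw : IsHomogeneousWeight (fun r : Matrix (Fin k) (Fin k) F => (w r : ℝ))) :
    (RespectsDuality w ↔ k = 2 ∧ Fintype.card F = 2) ∧
    (¬ (k = 2 ∧ Fintype.card F = 2) →
      (∀ r₁ r₂ : Matrix (Fin k) (Fin k) F, r₁.rank = 1 → r₂.rank = 2 →
        w r₂ < w r₁ ∧ w r₁ < 2 * w r₂) ∧
      ∃ n : ℕ, 1 ≤ n ∧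
        ∃ C D : Submodule (Matrix (Fin k) (Fin k) F) (Fin n → Matrix (Fin k) (Fin k) F),
          weightEnumerator w (C : Set (Fin n → Matrix (Fin k) (Fin k) F)) =
            weightEnumerator w (D : Set (Fin n → Matrix (Fin k) (Fin k) F)) ∧
          ∀ r₁ : Matrix (Fin k) (Fin k) F, r₁.rank = 1 →
            weightCount w (w r₁) (rightDual C : Set (Fin n → Matrix (Fin k) (Fin k) F)) ≠
              weightCount w (w r₁) (rightDual D : Set (Fin n → Matrix (Fin k) (Fin k) F))) := by
  refine ⟨⟨fun hdual => ?_, ?_⟩, fun h22 => ⟨fun r₁ r₂ h₁ h₂ => ?_,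
    hw.exists_weightEnumerator_eq_and_weightCount_ne hk h22⟩⟩
  · by_contra h22
    obtain ⟨n, hn, C, D, hCD, hne⟩ := hw.exists_weightEnumerator_eq_and_weightCount_ne hk h22
    have hrank : (Matrix.vecMulVec (Pi.single ⟨0, by omega⟩ 1) (Pi.single ⟨0, by omega⟩ 1) :
        Matrix (Fin k) (Fin k) F).rank = 1 := by
      refine le_antisymm (Matrix.rank_vecMulVec_le _ _) (Nat.one_le_iff_ne_zero.mpr fun h => ?_)
      have := congrFun (congrFun (rank_eq_zero_iff_eq_zero.mp h) ⟨0, by omega⟩) ⟨0, by omega⟩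
      simp [Matrix.vecMulVec_apply] at this
    exact hne _ hrank (weightCount_eq_of_weightEnumerator_eq (hdual n hn C D hCD) _)
  · rintro ⟨rfl, hF⟩
    classical
    exact hw.respectsDuality hF
  · have hr₂ : r₂ ≠ 0 := fun h => by simp [h] at h₂
    obtain ⟨hlt, hiff, hle⟩ := hw.lt_two_mul_and_eq_iff hk h22 h₁ hr₂
    refine ⟨lt_of_le_of_ne hle fun h => ?_, hlt⟩
    have := hiff.mp h
    omega
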